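/- Let $n\ge 1$ and $t>0$. For $\psi\in L^2(\mathbb{R}^n)$ let $\hat\psi$ denote its Fourier transform, $\hat\psi(\xi)=(2\pi)^{-n/2}\int_{\mathbb{R}^n}\psi(x)e^{-ix\cdot\xi}\,dx$, extended unitarily to $L^2(\mathbb{R}^n)$. For $\alpha\in\mathbb{N}^n$ (where $0\in\mathbb{N}$), put $|\alpha|=\alpha_1+\dots+\alpha_n$ and let $\Phi_\alpha(x)=\prod_{j=1}^n h_{\alpha_j}(x_j)$ be the normalized Hermite function, where $h_k(s)=(2^k k!\sqrt{\pi})^{-1/2}(-1)^k e^{s^2/2}\frac{d^k}{ds^k}e^{-s^2}$. Let $(\psi,\Phi_\alpha)=\int_{\mathbb{R}^n}\psi(x)\Phi_\alpha(x)\,dx$. Then there is a constant $K_{n,t}$, depending only on $n$ and $t$, such that for every real $C$ and every $\psi\in L^2(\mathbb{R}^n)$ satisfying, for almost all $x,\xi\in\mathbb{R}^n$, $$|\psi(x)|\le C e^{-\frac12\tanh(2t)|x|^2},\qquad |\hat\psi(\xi)|\le C e^{-\frac12\tanh(2t)|\xi|^2},$$ one has, for every $\alpha\in\mathbb{N}^n$,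 $$|(\psi,\Phi_\alpha)|\le K_{n,t}\,C\prod_{j=1}^n(2\alpha_j+1)^{-\frac{1}{4n}}\;e^{-(2|\alpha|+n)\frac{t}{2n}}.$$ -/

import Mathlib

open MeasureTheory
open scoped FourierTransform

noncomputable section

/-- The unitary Fourier transform `ψ̂(ξ) = (2π)^{-n/2} ∫ ψ(x) e^{-i x·ξ} dx` on `L²(ℝⁿ)`, as a
function defined up to null sets. Mathlib's `𝓕` on `L²` is the Plancherel extension of
`ξ ↦ ∫ ψ(x) e^{-2πi x·ξ} dx`, so it has to be evaluated at `ξ / (2π)` and rescaled. -/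
def unitaryFourier {n : ℕ} (ψ : Lp ℂ 2 (volume : Measure (EuclideanSpace ℝ (Fin n)))) :
    EuclideanSpace ℝ (Fin n) → ℂ :=
  fun ξ => (((2 * Real.pi) ^ (-(n : ℝ) / 2) : ℝ) : ℂ) *
    (𝓕 ψ : Lp ℂ 2 (volume : Measure (EuclideanSpace ℝ (Fin n)))) ((2 * Real.pi)⁻¹ • ξ)

/-- The `L²`-normalized one-dimensional Hermite function
`h_k(x) = (2^k k! √π)^{-1/2} H_k(x) e^{-x²/2}`. Here `H_k` is the physicists' Hermite polynomial,
`H_k(x) = 2^{k/2} He_k(√2 x)`, and Mathlib's `Polynomial.hermite k` is the probabilists' `He_k`. -/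
def hermiteFun (k : ℕ) (x : ℝ) : ℝ :=
  (Real.sqrt (k.factorial * Real.sqrt Real.pi))⁻¹ *
    Polynomial.aeval (Real.sqrt 2 * x) (Polynomial.hermite k) * Real.exp (-x ^ 2 / 2)

/-- The normalized Hermite function `Φ_α(x) = ∏_j h_{α_j}(x_j)` on `ℝⁿ`. -/
def hermiteFunMulti {n : ℕ} (α : Fin n → ℕ) (x : EuclideanSpace ℝ (Fin n)) : ℝ :=
  ∏ j, hermiteFun (α j) (x j)

/-- The Fourier-Hermite coefficient `(ψ, Φ_α)`, the `L²` inner product (`Φ_α` is real valued). -/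
def hermiteCoeff {n : ℕ} (ψ : Lp ℂ 2 (volume : Measure (EuclideanSpace ℝ (Fin n))))
    (α : Fin n → ℕ) : ℂ :=
  ∫ x, ψ x * (hermiteFunMulti α x : ℂ)

end

/-! Freeze every index except the `j`-th and put the coefficients `a k`, with `k` in slot `j`, into
the entire function `F z = ∑ a k * z ^ k / √(k!)`. This is a Bargmann transform: `F` pairs `ψ` with
the Bargmann kernel in `x j` and with Hermite functions in the other variables. Completing the
square, the decay of `ψ` gives `‖F z‖ ≤ M exp(y²/2 + e^{-4t} x²/2)` for `z = x + iy`, because `(1 -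
tanh 2t)/(1 + tanh 2t) = e^{-4t}`. Hermite functions are Fourier eigenfunctions with eigenvalues
`(-i)^|α|`, so passing to the Fourier transform rotates `F` by a quarter turn, and the decay of the
transform gives the same bound with `x` and `y` exchanged.

Each bound is good near one axis only. Phragmén-Lindelöf in the sectors around the diagonals
interpolates between them and yields growth `exp(e^{-2t} r²/2)` at worst, with a Gaussian drop in
the angle away from the diagonals (`norm_polar_le`). Cauchy's formula averaged over a circle with
`r² = (k + 1/2) e^{2t}` gains a factor `1/r` from this drop, and Stirling's formula turns the result
into `(2k+1)^{-1/4} e^{-(2k+1)t/2}` (`exists_norm_coeff_le`).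

The constants do not depend on the frozen indices, so this bound holds for each `j`; the geometric
mean of the `n` bounds is the theorem. -/

/-! ### Phragmén-Lindelöf bounds and the angular integral. -/

/-- Phragmen-Lindelöf in a sector strictly inside a quadrant, in the coordinate `z = exp ζ`. -/
theorem norm_comp_exp_le_of_sector {F : ℂ → ℂ} (hF : Differentiable ℂ F) {M p φ : ℝ} (hp : 0 ≤ p)
    (hφ : 0 < φ) (hφ' : φ < Real.pi / 2)
    (H : ∀ z : ℂ, ‖F z‖ ≤ M * Real.exp (p * (‖z‖ ^ 2 - Real.cos φ * |(z ^ 2).re|)))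
    (ζ : ℂ) (h1 : φ / 2 ≤ ζ.im) (h2 : ζ.im ≤ Real.pi / 2 - φ / 2) :
    ‖F (Complex.exp ζ)‖ ≤
      M * Real.exp (p * Real.sin φ * Real.exp (2 * ζ.re) * Real.sin (2 * ζ.im)) := by
  have hM : 0 ≤ M := by simpa using (norm_nonneg _).trans (H 0)
  have hcos : 0 < Real.cos φ := Real.cos_pos_of_mem_Ioo ⟨by linarith, hφ'⟩
  set b := p * Real.sin φ with hb
  have hb0 : 0 ≤ b := mul_nonneg hp (Real.sin_pos_of_pos_of_lt_pi hφ (by linarith)).le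
  -- The multiplier has modulus `exp(-b e^{2 Re ζ} sin(2 Im ζ))`. On both edges of the strip it
  -- cancels the growth allowed by `H` exactly, since `1 - cos² φ = sin² φ`.
  let f : ℂ → ℂ := fun ζ => F (Complex.exp ζ) * Complex.exp (Complex.I * b * Complex.exp (2 * ζ))
  have hfd : Differentiable ℂ f := by
    refine (hF.comp Complex.differentiable_exp).mul ?_
    fun_prop
  have hnorm : ∀ ζ : ℂ, ‖f ζ‖ = ‖F (Complex.exp ζ)‖ *
      Real.exp (-(b * Real.exp (2 * ζ.re) * Real.sin (2 * ζ.im))) := by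
    intro ζ
    simp only [f, norm_mul, Complex.norm_exp]
    congr 2
    have : (Complex.exp (2 * ζ)).im = Real.exp (2 * ζ.re) * Real.sin (2 * ζ.im) := by
      rw [Complex.exp_im]; simp
    rw [mul_assoc, Complex.I_mul_re, Complex.im_ofReal_mul, this]
    ring
  have hHexp : ∀ ζ : ℂ, ‖F (Complex.exp ζ)‖ ≤ M * Real.exp (p * (Real.exp (2 * ζ.re) *
      (1 - Real.cos φ * |Real.cos (2 * ζ.im)|))) := by
    intro ζ
    refine (H _).trans_eq ?_
    have h1 : ‖Complex.exp ζ‖ ^ 2 = Real.exp (2 * ζ.re) := by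
      rw [Complex.norm_exp, ← Real.exp_nat_mul]; norm_num
    have h2 : ((Complex.exp ζ) ^ 2).re = Real.exp (2 * ζ.re) * Real.cos (2 * ζ.im) := by
      rw [← Complex.exp_nat_mul, Complex.exp_re]; simp
    rw [h1, h2, abs_mul, abs_of_pos (Real.exp_pos _)]
    congr 2; ring
  have hbd : ∀ ζ : ℂ, |Real.cos (2 * ζ.im)| = Real.cos φ → Real.sin (2 * ζ.im) = Real.sin φ →
      ‖f ζ‖ ≤ M := by
    intro ζ hc hs
    rw [hnorm, hs]
    refine (mul_le_mul_of_nonneg_right (hHexp ζ) (Real.exp_pos _).le).trans_eq ?_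
    rw [mul_assoc, ← Real.exp_add, hc, hb]
    have : p * (Real.exp (2 * ζ.re) * (1 - Real.cos φ * Real.cos φ)) +
        -(p * Real.sin φ * Real.exp (2 * ζ.re) * Real.sin φ) = 0 := by
      linear_combination (-p * Real.exp (2 * ζ.re)) * (Real.sin_sq_add_cos_sq φ)
    rw [this]; simp
  have key : ‖f ζ‖ ≤ M := by
    refine PhragmenLindelof.horizontal_strip (a := φ / 2) (b := Real.pi / 2 - φ / 2)
      hfd.diffContOnCl ?_ ?_ ?_ h1 h2
    · refine ⟨2, ?_, p + b, ?_⟩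
      -- The strip has width `π/2 - φ`, so the critical exponent `π / (π/2 - φ)` exceeds the growth
      -- exponent 2 precisely because `φ > 0`.
      · rw [lt_div_iff₀ (by linarith)]; linarith
      · refine Asymptotics.IsBigO.of_bound M (Filter.Eventually.of_forall fun z => ?_)
        rw [hnorm, Real.norm_of_nonneg (Real.exp_pos _).le]
        refine (mul_le_mul_of_nonneg_right (hHexp z) (Real.exp_pos _).le).trans ?_
        rw [mul_assoc, ← Real.exp_add]
        gcongr
        have e1 : Real.exp (2 * z.re) ≤ Real.exp (2 * |z.re|) := by gcongr; exact le_abs_self _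
        have e2 : 0 ≤ Real.cos φ * |Real.cos (2 * z.im)| := by positivity
        have e3 : Real.exp (2 * z.re) * (1 - Real.cos φ * |Real.cos (2 * z.im)|) ≤
            Real.exp (2 * |z.re|) := by nlinarith [Real.exp_pos (2 * z.re)]
        have e4 : -(b * Real.exp (2 * z.re) * Real.sin (2 * z.im)) ≤
            b * Real.exp (2 * |z.re|) := by
          have : -Real.sin (2 * z.im) ≤ 1 := by linarith [Real.neg_one_le_sin (2 * z.im)]
          calc -(b * Real.exp (2 * z.re) * Real.sin (2 * z.im))
              = (b * Real.exp (2 * z.re)) * -Real.sin (2 * z.im) := by ring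
            _ ≤ (b * Real.exp (2 * z.re)) * 1 := by gcongr
            _ ≤ _ := by rw [mul_one]; gcongr
        have := mul_le_mul_of_nonneg_left e3 hp
        linarith
    · intro z hz
      have : 2 * z.im = φ := by rw [hz]; ring
      exact hbd z (by rw [this, abs_of_pos hcos]) (by rw [this])
    · intro z hz
      have : 2 * z.im = Real.pi - φ := by rw [hz]; ring
      exact hbd z (by rw [this, Real.cos_pi_sub, abs_neg, abs_of_pos hcos])
        (by rw [this, Real.sin_pi_sub])
  rw [hnorm, Real.exp_neg, ← div_eq_mul_inv, div_le_iff₀ (Real.exp_pos _)] at key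
  exact key

/-- The sector bound in polar coordinates, valid in all directions with `|cos 2θ| ≤ cos φ`. -/
theorem norm_polar_le_of_sector {F : ℂ → ℂ} (hF : Differentiable ℂ F) {M p φ : ℝ} (hp : 0 ≤ p)
    (hφ : 0 < φ) (hφ' : φ < Real.pi / 2)
    (H : ∀ z : ℂ, ‖F z‖ ≤ M * Real.exp (p * (‖z‖ ^ 2 - Real.cos φ * |(z ^ 2).re|)))
    (z : ℂ) (hz : z ≠ 0) (hc : |(z ^ 2).re| ≤ Real.cos φ * ‖z‖ ^ 2) :
    ‖F z‖ ≤ M * Real.exp (p * Real.sin φ * |(z ^ 2).im|) := by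
  -- Hypotheses and conclusion involve only `‖z‖`, `|Re z²|` and `|Im z²|`, all invariant under `z ↦
  -- -z` and `z ↦ iz`; the first quadrant suffices.
  wlog hre : 0 ≤ z.re generalizing F z
  · have := this (F := fun w => F (-w)) (hF.comp differentiable_neg) (fun w => by simpa using H (-w))
      (-z) (by simpa using hz) (by simpa using hc) (by simp; linarith)
    simpa using this
  wlog him : 0 ≤ z.im generalizing F z
  · have hI2 : ∀ w : ℂ, (Complex.I * w) ^ 2 = -w ^ 2 := fun w => by
      rw [mul_pow, Complex.I_sq]; ring
    have hI2' : ∀ w : ℂ, (-Complex.I * w) ^ 2 = -w ^ 2 := fun w => by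
      rw [mul_pow, neg_sq, Complex.I_sq]; ring
    have := this (F := fun w => F (-Complex.I * w)) (hF.comp (differentiable_id.const_mul _))
      (fun w => by have := H (-Complex.I * w); rw [hI2'] at this; simpa using this)
      (Complex.I * z) (by simpa using hz) (by simpa [hI2] using hc) (by simp; linarith)
      (by simpa using hre)
    have e : -Complex.I * (Complex.I * z) = z := by
      rw [← mul_assoc]; simp
    simp only [e, hI2, Complex.neg_im, abs_neg] at this
    exact this
  obtain ⟨ζ, hζ0, hζ1, rfl⟩ : ∃ ζ : ℂ, 0 ≤ ζ.im ∧ ζ.im ≤ Real.pi / 2 ∧ Complex.exp ζ = z := by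
    refine ⟨Complex.log z, ?_, ?_, Complex.exp_log hz⟩
    · rw [Complex.log_im]; exact Complex.arg_nonneg_iff.2 him
    · rw [Complex.log_im]; exact Complex.arg_le_pi_div_two_iff.2 (Or.inl hre)
  have e1 : ‖Complex.exp ζ‖ ^ 2 = Real.exp (2 * ζ.re) := by
    rw [Complex.norm_exp, ← Real.exp_nat_mul]; norm_num
  have e2 : ((Complex.exp ζ) ^ 2).re = Real.exp (2 * ζ.re) * Real.cos (2 * ζ.im) := by
    rw [← Complex.exp_nat_mul, Complex.exp_re]; simp
  have e3 : ((Complex.exp ζ) ^ 2).im = Real.exp (2 * ζ.re) * Real.sin (2 * ζ.im) := by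
    rw [← Complex.exp_nat_mul, Complex.exp_im]; simp
  have hpos := Real.exp_pos (2 * ζ.re)
  rw [e1, e2, abs_mul, abs_of_pos hpos, mul_comm, mul_le_mul_iff_left₀ hpos] at hc
  have hc' := abs_le.1 hc
  have hsin : 0 ≤ Real.sin (2 * ζ.im) :=
    Real.sin_nonneg_of_nonneg_of_le_pi (by linarith) (by linarith)
  rw [e3, abs_mul, abs_of_pos hpos, abs_of_nonneg hsin, ← mul_assoc]
  refine norm_comp_exp_le_of_sector hF hp hφ hφ' H ζ ?_ ?_
  · by_contra! h
    have := Real.cos_lt_cos_of_nonneg_of_le_pi (x := 2 * ζ.im) (y := φ) (by linarith) (by linarith)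
      (by linarith)
    linarith [hc'.2]
  · by_contra! h
    have := Real.cos_lt_cos_of_nonneg_of_le_pi (x := Real.pi - φ) (y := 2 * ζ.im) (by linarith)
      (by linarith) (by linarith)
    rw [Real.cos_pi_sub] at this
    linarith [hc'.1]

/-- The Phragmen-Lindelöf bound as a Gaussian bound peaked at `cos 2θ = 0`. -/
theorem norm_polar_le {F : ℂ → ℂ} (hF : Differentiable ℂ F) {M p φ : ℝ} (hp : 0 ≤ p)
    (hφ : 0 < φ) (hφ' : φ < Real.pi / 2)
    (H : ∀ z : ℂ, ‖F z‖ ≤ M * Real.exp (p * (‖z‖ ^ 2 - Real.cos φ * |(z ^ 2).re|)))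
    (r θ : ℝ) (hr : 0 < r) :
    ‖F (circleMap 0 r θ)‖ ≤ M * Real.exp (p * Real.sin φ * r ^ 2) * Real.exp
      (-(p * Real.sin φ * (1 - Real.sin φ) / 2 * r ^ 2 * Real.cos (2 * θ) ^ 2)) := by
  have hM : 0 ≤ M := by simpa using (norm_nonneg _).trans (H 0)
  have hcos : 0 < Real.cos φ := Real.cos_pos_of_mem_Ioo ⟨by linarith, hφ'⟩
  have hs0 : 0 < Real.sin φ := Real.sin_pos_of_pos_of_lt_pi hφ (by linarith)
  have hs1 : Real.sin φ ≤ 1 := Real.sin_le_one _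
  set z := circleMap 0 r θ with hzdef
  have hz : z = r * Complex.exp (θ * Complex.I) := by simp [hzdef, circleMap]
  have hzn : ‖z‖ = r := by simp [hzdef, abs_of_pos hr]
  have hz2 : z ^ 2 = ((r ^ 2 : ℝ) : ℂ) * Complex.exp ((2 * θ : ℝ) * Complex.I) := by
    rw [hz, mul_pow, ← Complex.exp_nat_mul]; push_cast; ring_nf
  have hre : (z ^ 2).re = r ^ 2 * Real.cos (2 * θ) := by
    rw [hz2, Complex.re_ofReal_mul, Complex.exp_ofReal_mul_I_re]
  have him : (z ^ 2).im = r ^ 2 * Real.sin (2 * θ) := by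
    rw [hz2, Complex.im_ofReal_mul, Complex.exp_ofReal_mul_I_im]
  have hr2 : 0 < r ^ 2 := by positivity
  have hcs := Real.sin_sq_add_cos_sq (2 * θ)
  have hcsφ := Real.sin_sq_add_cos_sq φ
  rw [mul_assoc, ← Real.exp_add]
  by_cases hc : |Real.cos (2 * θ)| ≤ Real.cos φ
  · refine (norm_polar_le_of_sector hF hp hφ hφ' H z ?_ ?_).trans ?_
    · intro h; rw [h] at hzn; simp at hzn; linarith
    · rw [hre, hzn, abs_mul, abs_of_pos hr2, mul_comm]; gcongr
    · gcongr
      rw [him, abs_mul, abs_of_pos hr2]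
      -- This is `√(1 - u) ≤ 1 - u/2` with `u = cos² 2θ`.
      have hsn : |Real.sin (2 * θ)| ≤ 1 - Real.cos (2 * θ) ^ 2 / 2 := by
        rw [abs_le]
        constructor <;> nlinarith [sq_nonneg (Real.sin (2 * θ) - 1), sq_nonneg (Real.sin (2 * θ) + 1)]
      have hw : 0 ≤ p * Real.sin φ * r ^ 2 := by positivity
      have h1 := mul_le_mul_of_nonneg_left hsn hw
      have h2 : p * Real.sin φ * r ^ 2 * ((1 - Real.sin φ) * (Real.cos (2 * θ) ^ 2 / 2)) ≤
          p * Real.sin φ * r ^ 2 * (Real.cos (2 * θ) ^ 2 / 2) :=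
        mul_le_mul_of_nonneg_left
          (mul_le_of_le_one_left (by positivity) (by linarith)) hw
      linarith
  -- Near the axes the original bound suffices: `1 - cos φ |cos 2θ| ≤ sin² φ = sin φ - sin φ (1 -
  -- sin φ)`. The factor `1 - sin φ` in the Gaussian rate is there for this case.
  · push Not at hc
    refine (H z).trans ?_
    gcongr
    rw [hre, hzn, abs_mul, abs_of_pos hr2]
    have hc2 : Real.cos (2 * θ) ^ 2 ≤ 1 := by nlinarith [sq_nonneg (Real.sin (2 * θ))]
    have hpr : 0 ≤ p * r ^ 2 := by positivity
    have h1 : p * r ^ 2 * (Real.cos φ * Real.cos φ) ≤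
        p * r ^ 2 * (Real.cos φ * |Real.cos (2 * θ)|) := by gcongr
    have h2 : p * r ^ 2 * (Real.sin φ * (1 - Real.sin φ) * (Real.cos (2 * θ) ^ 2 / 2)) ≤
        p * r ^ 2 * (Real.sin φ * (1 - Real.sin φ) * 1) := by
      have : 0 ≤ Real.sin φ * (1 - Real.sin φ) := mul_nonneg hs0.le (by linarith)
      gcongr; linarith
    have h3 : p * r ^ 2 * (Real.cos φ * Real.cos φ) = p * r ^ 2 * (1 - Real.sin φ ^ 2) := by
      rw [← hcsφ]; ring
    nlinarith

/-- A Laplace-type bound for the angular integral. -/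
theorem integral_exp_neg_mul_cos_sq_le {c : ℝ} (hc : 0 < c) :
    ∫ θ in (0 : ℝ)..2 * Real.pi, Real.exp (-(c * Real.cos (2 * θ) ^ 2)) ≤
      2 * Real.sqrt (Real.pi / (c * (2 / Real.pi) ^ 2)) := by
  set g : ℝ → ℝ := fun φ => Real.exp (-(c * Real.cos φ ^ 2)) with hg
  have hgc : Continuous g := by fun_prop
  have hper : Function.Periodic g Real.pi := fun x => by
    simp [hg, Real.cos_add_pi]
  have h1 : ∫ θ in (0 : ℝ)..2 * Real.pi, Real.exp (-(c * Real.cos (2 * θ) ^ 2)) =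
      2 * ∫ φ in (0 : ℝ)..Real.pi, g φ := by
    have := intervalIntegral.integral_comp_mul_left (a := 0) (b := 2 * Real.pi) g
      (two_ne_zero (α := ℝ))
    change ∫ θ in (0 : ℝ)..2 * Real.pi, g (2 * θ) = _
    rw [this]
    have h4 := hper.intervalIntegral_add_zsmul_eq (n := 4) (t := 0)
    have e : (2 * (2 * Real.pi)) = 0 + (4 : ℤ) • Real.pi := by simp; ring
    rw [e, mul_zero, h4 (fun a b => hgc.intervalIntegrable a b)]
    simp; ring
  rw [h1]
  gcongr
  -- Shifting by `π/2` centres the peak at 0, where `|sin x| ≥ (2/π)|x|` gives a Gaussian majorant.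
  have h2 : ∫ φ in (0 : ℝ)..Real.pi, g φ =
      ∫ φ in (-(Real.pi / 2))..(Real.pi / 2), Real.exp (-(c * Real.sin φ ^ 2)) := by
    have := intervalIntegral.integral_comp_add_right (a := -(Real.pi / 2)) (b := Real.pi / 2) g
      (Real.pi / 2)
    rw [show -(Real.pi / 2) + Real.pi / 2 = 0 by ring,
      show Real.pi / 2 + Real.pi / 2 = Real.pi by ring] at this
    rw [← this]
    simp [hg, Real.cos_add_pi_div_two]
  rw [h2]
  have hpi := Real.pi_pos
  have hd : 0 < c * (2 / Real.pi) ^ 2 := by positivity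
  calc ∫ φ in (-(Real.pi / 2))..(Real.pi / 2), Real.exp (-(c * Real.sin φ ^ 2))
      ≤ ∫ φ in (-(Real.pi / 2))..(Real.pi / 2), Real.exp (-(c * (2 / Real.pi) ^ 2) * φ ^ 2) := by
        refine intervalIntegral.integral_mono_on (by linarith) ?_ ?_ ?_
        · exact Continuous.intervalIntegrable (by fun_prop) _ _
        · exact Continuous.intervalIntegrable (by fun_prop) _ _
        · intro x hx
          gcongr
          have : (2 / Real.pi * |x|) ^ 2 ≤ Real.sin x ^ 2 := by
            rw [← sq_abs (Real.sin x)]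
            gcongr
            exact Real.mul_abs_le_abs_sin (abs_le.2 hx)
          rw [mul_pow, sq_abs] at this
          nlinarith
    _ ≤ ∫ φ : ℝ, Real.exp (-(c * (2 / Real.pi) ^ 2) * φ ^ 2) := by
        rw [intervalIntegral.integral_of_le (by linarith)]
        exact setIntegral_le_integral (integrable_exp_neg_mul_sq hd)
          (Filter.Eventually.of_forall fun x => (Real.exp_pos _).le)
    _ = _ := integral_gaussian _

/-! ### Coefficient estimates: Cauchy and Stirling. -/

/-- An everywhere convergent power series defines an entire function with that power series. -/
theorem hasFPowerSeriesOnBall_of_hasSum {a : ℕ → ℂ} {F : ℂ → ℂ}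
    (h : ∀ z, HasSum (fun k => a k * z ^ k) (F z)) :
    HasFPowerSeriesOnBall F (FormalMultilinearSeries.ofScalars ℂ a) 0 ⊤ where
  r_le := by
    refine ENNReal.le_of_forall_nnreal_lt fun r _ => ?_
    refine FormalMultilinearSeries.le_radius_of_tendsto _ (l := 0) ?_
    have := (h r).summable.tendsto_atTop_zero.norm
    simpa [FormalMultilinearSeries.ofScalars_norm] using this
  r_pos := by simp
  hasSum := by
    intro y _
    simpa [FormalMultilinearSeries.ofScalars_apply_eq, mul_comm] using h y

/-- Cauchy's estimate with the mean over the circle in place of the maximum; the mean is what gains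
the factor `1/r` later. -/
theorem norm_coeff_mul_pow_le {a : ℕ → ℂ} {F : ℂ → ℂ}
    (h : ∀ z, HasSum (fun k => a k * z ^ k) (F z)) (k : ℕ) {r : ℝ} (hr : 0 < r) :
    ‖a k‖ * r ^ k ≤ (2 * Real.pi)⁻¹ * ∫ θ in (0 : ℝ)..2 * Real.pi, ‖F (circleMap 0 r θ)‖ := by
  have hp := hasFPowerSeriesOnBall_of_hasSum h
  have hd : Differentiable ℂ F := fun z => (hp.analyticAt_of_mem (by simp)).differentiableAt
  lift r to NNReal using hr.le
  have hc := hd.hasFPowerSeriesOnBall 0 (R := r) (by exact_mod_cast hr)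
  have heq := hp.hasFPowerSeriesAt.eq_formalMultilinearSeries hc.hasFPowerSeriesAt
  have hn := norm_cauchyPowerSeries_le F 0 r k
  rw [← heq, FormalMultilinearSeries.ofScalars_norm, abs_of_pos hr, inv_pow,
    ← div_eq_mul_inv, le_div_iff₀ (by positivity)] at hn
  exact hn

/-- The Stirling sequence decreases from its first term `e/√2`. Writing `k + 1/2` in place of `k`
admits `k = 0` and produces the weight `2k + 1`. -/
theorem factorial_le_stirling (k : ℕ) : (k.factorial : ℝ) ≤
    Real.exp 1 * Real.sqrt (k + 1 / 2) * ((k + 1 / 2) / Real.exp 1) ^ k := by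
  rcases Nat.eq_zero_or_pos k with rfl | hk
  · have h : (1 / 2 : ℝ) ≤ Real.sqrt (1 / 2) := by
      rw [Real.le_sqrt (by norm_num) (by norm_num)]; norm_num
    have := Real.add_one_le_exp (1 : ℝ)
    simp only [Nat.factorial_zero, Nat.cast_one, pow_zero, mul_one, Nat.cast_zero, zero_add]
    nlinarith
  · obtain ⟨m, rfl⟩ := Nat.exists_eq_succ_of_ne_zero hk.ne'
    have h := Stirling.stirlingSeq'_antitone (Nat.zero_le m)
    simp only [Function.comp, Nat.succ_eq_add_one, zero_add, Stirling.stirlingSeq_one] at h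
    rw [Stirling.stirlingSeq, div_le_iff₀ (by positivity)] at h
    refine h.trans ?_
    have hs : Real.exp 1 / Real.sqrt 2 * Real.sqrt (2 * ((m + 1 : ℕ) : ℝ)) =
        Real.exp 1 * Real.sqrt ((m + 1 : ℕ) : ℝ) := by
      rw [Real.sqrt_mul (by norm_num)]; field_simp
    rw [← mul_assoc, hs]
    gcongr <;> linarith

/-- With `y = k + 1/2`, the square of the claim is Stirling's bound times `e^y`, as `e √y (y/e)^k
e^y = e^{3/2} y^{k+1/2}`. -/
theorem sqrt_factorial_mul_exp_le (k : ℕ) :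
    Real.sqrt k.factorial * Real.exp ((k + 1 / 2) / 2) ≤
      Real.exp (3 / 4) * (k + 1 / 2 : ℝ) ^ (-(1 / 4) : ℝ) * Real.sqrt (k + 1 / 2) ^ (k + 1) := by
  have hy : (0 : ℝ) < k + 1 / 2 := by positivity
  set y : ℝ := k + 1 / 2 with hydef
  refine (sq_le_sq₀ (by positivity) (by positivity)).1 ?_
  rw [mul_pow, mul_pow, mul_pow, Real.sq_sqrt (by positivity), ← Real.exp_nat_mul,
    ← Real.exp_nat_mul, ← pow_mul, mul_comm (k + 1) 2, pow_mul, Real.sq_sqrt hy.le,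
    ← Real.rpow_natCast (y ^ _), ← Real.rpow_mul hy.le]
  have h := factorial_le_stirling k
  rw [← hydef] at h
  refine (mul_le_mul_of_nonneg_right h (Real.exp_pos _).le).trans_eq ?_
  have e1 : Real.sqrt y = y ^ (-(1 / 4) * ((2 : ℕ) : ℝ) : ℝ) * y := by
    rw [Real.sqrt_eq_rpow]
    nth_rw 3 [← Real.rpow_one y]
    rw [← Real.rpow_add hy]; norm_num
  have e2 : Real.exp (((2 : ℕ) : ℝ) * (y / 2)) = Real.exp 1 ^ k * Real.exp (1 / 2) := by
    rw [← Real.exp_nat_mul, ← Real.exp_add]; congr 1; rw [hydef]; push_cast; ring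
  have e3 : Real.exp (((2 : ℕ) : ℝ) * (3 / 4)) = Real.exp 1 * Real.exp (1 / 2) := by
    rw [← Real.exp_add]; norm_num
  rw [e1, e2, e3, div_pow, pow_succ]
  field_simp

/-- Coefficient bounds for an entire function whose Gaussian growth is controlled by the same
anisotropic Gaussian along both axes. -/
theorem exists_norm_coeff_le {t : ℝ} (ht : 0 < t) :
    ∃ K : ℝ, 0 ≤ K ∧ ∀ (M : ℝ) (a : ℕ → ℂ) (F : ℂ → ℂ),
      (∀ z, HasSum (fun k => a k / (Real.sqrt k.factorial : ℂ) * z ^ k) (F z)) →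
      (∀ z, ‖F z‖ ≤ M * Real.exp (z.im ^ 2 / 2 + Real.exp (-4 * t) * z.re ^ 2 / 2)) →
      (∀ z, ‖F z‖ ≤ M * Real.exp (z.re ^ 2 / 2 + Real.exp (-4 * t) * z.im ^ 2 / 2)) →
      ∀ k, ‖a k‖ ≤ K * M * (2 * (k : ℝ) + 1) ^ (-(1 / 4) : ℝ) *
        Real.exp (-((2 * (k : ℝ) + 1) * t / 2)) := by
  set ε := Real.exp (-4 * t) with hε
  have hε0 : 0 < ε := Real.exp_pos _
  have hε1 : ε < 1 := by rw [hε, Real.exp_lt_one_iff]; linarith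
  -- `p` and `φ` are such that `p (|z|² - cos φ |Re z²|)` is the smaller of the two Gaussian
  -- exponents at every `z`.
  set p := (1 + ε) / 4 with hp
  have hp0 : 0 < p := by positivity
  set φ := Real.arccos ((1 - ε) / (1 + ε)) with hφ
  have hx0 : 0 < (1 - ε) / (1 + ε) := div_pos (by linarith) (by linarith)
  have hx1 : (1 - ε) / (1 + ε) < 1 := by rw [div_lt_one (by linarith)]; linarith
  have hcos : Real.cos φ = (1 - ε) / (1 + ε) := Real.cos_arccos (by linarith) hx1.le
  have hφ0 : 0 < φ := Real.arccos_pos.2 hx1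
  have hφ1 : φ < Real.pi / 2 := Real.arccos_lt_pi_div_two.2 hx0
  have hs0 : 0 < Real.sin φ := Real.sin_pos_of_pos_of_lt_pi hφ0 (by linarith [Real.pi_pos])
  have hs1 : Real.sin φ < 1 := by
    have := Real.sin_sq_add_cos_sq φ
    rw [hcos] at this
    nlinarith [sq_pos_of_pos hx0]
  -- The type along the diagonals is `√ε / 2`.
  have hb : p * Real.sin φ = Real.exp (-2 * t) / 2 := by
    have he : ε = Real.exp (-2 * t) ^ 2 := by
      rw [hε, ← Real.exp_nat_mul]; congr 1; push_cast; ring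
    refine (sq_eq_sq₀ (by positivity) (by positivity)).1 ?_
    have := Real.sin_sq_add_cos_sq φ
    rw [hcos] at this
    have h2 : Real.sin φ ^ 2 = 1 - ((1 - ε) / (1 + ε)) ^ 2 := by linarith
    rw [mul_pow, h2, div_pow _ (2 : ℝ), ← he, hp]
    field_simp
    ring
  set c := p * Real.sin φ * (1 - Real.sin φ) / 2 with hc
  have hc0 : 0 < c := by
    have : 0 < 1 - Real.sin φ := by linarith
    positivity
  set D := (2 * Real.pi)⁻¹ * (2 * Real.sqrt (Real.pi / (c * (2 / Real.pi) ^ 2))) with hD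
  have hD0 : 0 ≤ D := by positivity
  refine ⟨D * Real.exp (3 / 4) * (1 / 2) ^ (-(1 / 4) : ℝ), by positivity, ?_⟩
  intro M a F hsum h1 h2 k
  have hM : 0 ≤ M := by simpa using (norm_nonneg _).trans (h1 0)
  have hd : Differentiable ℂ F := fun z =>
    ((hasFPowerSeriesOnBall_of_hasSum hsum).analyticAt_of_mem (by simp)).differentiableAt
  have H : ∀ z : ℂ, ‖F z‖ ≤ M * Real.exp (p * (‖z‖ ^ 2 - Real.cos φ * |(z ^ 2).re|)) := by
    intro z
    have e1 : (z ^ 2).re = z.re ^ 2 - z.im ^ 2 := by simp [sq]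
    have e2 : ‖z‖ ^ 2 = z.re ^ 2 + z.im ^ 2 := by
      rw [← Complex.normSq_eq_norm_sq, Complex.normSq_apply]; ring
    have e3 : p * Real.cos φ = (1 - ε) / 4 := by rw [hcos, hp]; field_simp
    have e4 : ∀ w : ℝ, p * (‖z‖ ^ 2 - Real.cos φ * w) = p * ‖z‖ ^ 2 - (1 - ε) / 4 * w := by
      intro w; rw [← e3]; ring
    rw [e4, e1, e2]
    rcases abs_cases (z.re ^ 2 - z.im ^ 2) with ⟨h, _⟩ | ⟨h, _⟩
    · refine (h1 z).trans_eq ?_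
      rw [h, hp]; congr 2; ring
    · refine (h2 z).trans_eq ?_
      rw [h, hp]; congr 2; ring
  set y : ℝ := k + 1 / 2 with hy
  have hy0 : 0 < y := by positivity
  -- This radius nearly minimizes `exp(p sin φ r²) r^{-(k+1)}` and makes the exponent exactly `y/2`.
  set r := Real.sqrt y * Real.exp t with hr
  have hr0 : 0 < r := by positivity
  have hr2 : r ^ 2 = y * Real.exp (2 * t) := by
    rw [hr, mul_pow, Real.sq_sqrt hy0.le, ← Real.exp_nat_mul]; norm_num
  have hbr : p * Real.sin φ * r ^ 2 = y / 2 := by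
    rw [hb, hr2]
    have : Real.exp (-2 * t) * Real.exp (2 * t) = 1 := by rw [← Real.exp_add]; simp
    linear_combination y / 2 * this
  have hF : Continuous F := hd.continuous
  have hint : (2 * Real.pi)⁻¹ * ∫ θ in (0 : ℝ)..2 * Real.pi, ‖F (circleMap 0 r θ)‖ ≤
      M * Real.exp (y / 2) * (D / r) := by
    have hle : ∫ θ in (0 : ℝ)..2 * Real.pi, ‖F (circleMap 0 r θ)‖ ≤
        ∫ θ in (0 : ℝ)..2 * Real.pi, M * Real.exp (y / 2) *
          Real.exp (-((c * r ^ 2) * Real.cos (2 * θ) ^ 2)) := by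
      refine intervalIntegral.integral_mono_on (by positivity) ?_ ?_ ?_
      · exact Continuous.intervalIntegrable (by fun_prop) _ _
      · exact Continuous.intervalIntegrable (by fun_prop) _ _
      · intro θ _
        have := norm_polar_le hd hp0.le hφ0 hφ1 H r θ hr0
        rwa [hbr] at this
    rw [intervalIntegral.integral_const_mul] at hle
    have hl := integral_exp_neg_mul_cos_sq_le (c := c * r ^ 2) (by positivity)
    have hsq : Real.sqrt (Real.pi / (c * r ^ 2 * (2 / Real.pi) ^ 2)) =
        Real.sqrt (Real.pi / (c * (2 / Real.pi) ^ 2)) / r := by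
      rw [← Real.sqrt_sq hr0.le, ← Real.sqrt_div (by positivity), Real.sqrt_sq hr0.le]
      congr 1; field_simp
    rw [hsq] at hl
    calc _ ≤ (2 * Real.pi)⁻¹ * (M * Real.exp (y / 2) *
          (2 * (Real.sqrt (Real.pi / (c * (2 / Real.pi) ^ 2)) / r))) := by
          gcongr; exact hle.trans (by gcongr)
      _ = _ := by rw [hD]; ring
  have hk := (norm_coeff_mul_pow_le hsum k hr0).trans hint
  have hfac : 0 < Real.sqrt k.factorial := by positivity
  rw [norm_div, Complex.norm_real, Real.norm_of_nonneg hfac.le] at hk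
  have hk2 : ‖a k‖ * r ^ (k + 1) ≤ M * D * (Real.sqrt k.factorial * Real.exp (y / 2)) := by
    calc ‖a k‖ * r ^ (k + 1) = (‖a k‖ / Real.sqrt k.factorial * r ^ k) *
          (Real.sqrt k.factorial * r) := by rw [pow_succ]; field_simp
      _ ≤ (M * Real.exp (y / 2) * (D / r)) * (Real.sqrt k.factorial * r) := by gcongr
      _ = _ := by field_simp
  have hst := sqrt_factorial_mul_exp_le k
  rw [← hy] at hst
  have hk3 := hk2.trans (mul_le_mul_of_nonneg_left hst (mul_nonneg hM hD0))
  rw [hr, mul_pow, ← Real.exp_nat_mul] at hk3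
  have hsy : 0 < Real.sqrt y ^ (k + 1) := by positivity
  have hk4 : ‖a k‖ * Real.exp (((k + 1 : ℕ) : ℝ) * t) ≤
      M * D * (Real.exp (3 / 4) * y ^ (-(1 / 4) : ℝ)) := by
    refine le_of_mul_le_mul_right ?_ hsy
    linarith
  have hyr : y ^ (-(1 / 4) : ℝ) = (1 / 2) ^ (-(1 / 4) : ℝ) * (2 * (k : ℝ) + 1) ^ (-(1 / 4) : ℝ) := by
    rw [← Real.mul_rpow (by norm_num) (by positivity)]; congr 1; rw [hy]; ring
  -- The argument gives the rate `(k+1)t`; only `(k + 1/2)t` is kept.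
  have hexp : Real.exp (-(((k + 1 : ℕ) : ℝ) * t)) ≤ Real.exp (-((2 * (k : ℝ) + 1) * t / 2)) := by
    gcongr; push_cast; linarith
  calc ‖a k‖ = ‖a k‖ * Real.exp (((k + 1 : ℕ) : ℝ) * t) * Real.exp (-(((k + 1 : ℕ) : ℝ) * t)) := by
        rw [mul_assoc, ← Real.exp_add]; simp
    _ ≤ M * D * (Real.exp (3 / 4) * y ^ (-(1 / 4) : ℝ)) *
        Real.exp (-((2 * (k : ℝ) + 1) * t / 2)) := by gcongr
    _ = _ := by rw [hyr]; ring

/-! ### One-dimensional Hermite functions and their Fourier transforms. -/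

open Polynomial in
theorem derivative_hermite_succ (k : ℕ) :
    derivative (hermite (k + 1)) = (k + 1 : ℤ[X]) * hermite k := by
  induction k with
  | zero => simp
  | succ k ih =>
    rw [hermite_succ (k + 1), derivative_sub, derivative_mul, derivative_X, ih, one_mul,
      hermite_succ k]
    have : derivative ((k + 1 : ℤ[X]) * hermite k) = (k + 1 : ℤ[X]) * derivative (hermite k) := by
      rw [derivative_mul]; simp
    rw [this]; push_cast; ring

/-- The Hermite function `He_k(√2 x) e^{-x²/2}` before normalization. -/
noncomputable def hermiteGauss (k : ℕ) (x : ℝ) : ℝ :=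
  Polynomial.aeval (Real.sqrt 2 * x) (Polynomial.hermite k) * Real.exp (-x ^ 2 / 2)

theorem hermiteFun_eq (k : ℕ) (x : ℝ) :
    hermiteFun k x = (Real.sqrt (k.factorial * Real.sqrt Real.pi))⁻¹ * hermiteGauss k x := by
  rw [hermiteFun, hermiteGauss, mul_assoc]

theorem hasDerivAt_hermiteGauss_aux (k : ℕ) (x : ℝ) : HasDerivAt (hermiteGauss k)
    (Real.sqrt 2 * Polynomial.aeval (Real.sqrt 2 * x) (Polynomial.derivative (Polynomial.hermite k))
      * Real.exp (-x ^ 2 / 2) - x * hermiteGauss k x) x := by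
  have h1 : HasDerivAt (fun x : ℝ => Real.sqrt 2 * x) (Real.sqrt 2) x := by
    simpa using (hasDerivAt_id x).const_mul (Real.sqrt 2)
  have h2 := ((Polynomial.hermite k).hasDerivAt_aeval (Real.sqrt 2 * x)).comp x h1
  have h3 : HasDerivAt (fun x : ℝ => Real.exp (-x ^ 2 / 2)) (Real.exp (-x ^ 2 / 2) * (-x)) x := by
    refine HasDerivAt.congr_deriv ((((hasDerivAt_id x).pow 2).neg.div_const 2).exp) ?_
    simp; ring
  refine HasDerivAt.congr_deriv (h2.mul h3) ?_
  simp only [hermiteGauss, Function.comp]; ring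

/-- The raising relation, from `He_{k+1} = X He_k - He_k'`. With the lowering relation below it
yields the norms; by itself it yields the Fourier eigenvalues. -/
theorem hasDerivAt_hermiteGauss (k : ℕ) (x : ℝ) :
    HasDerivAt (hermiteGauss k) (x * hermiteGauss k x - Real.sqrt 2 * hermiteGauss (k + 1) x) x := by
  refine (hasDerivAt_hermiteGauss_aux k x).congr_deriv (Eq.symm ?_)
  simp only [hermiteGauss, Polynomial.hermite_succ, map_sub, map_mul, Polynomial.aeval_X]
  have := Real.mul_self_sqrt (show (0 : ℝ) ≤ 2 by norm_num)
  linear_combination (-x * (Polynomial.aeval (Real.sqrt 2 * x)) (Polynomial.hermite k) *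
    Real.exp (-x ^ 2 / 2)) * this

theorem hasDerivAt_hermiteGauss_succ (k : ℕ) (x : ℝ) : HasDerivAt (hermiteGauss (k + 1))
    (Real.sqrt 2 * (k + 1) * hermiteGauss k x - x * hermiteGauss (k + 1) x) x := by
  refine (hasDerivAt_hermiteGauss_aux (k + 1) x).congr_deriv (Eq.symm ?_)
  rw [derivative_hermite_succ]
  simp only [hermiteGauss, map_mul, map_add, map_natCast, map_one]
  ring

theorem differentiable_hermiteGauss (k : ℕ) : Differentiable ℝ (hermiteGauss k) :=
  fun x => (hasDerivAt_hermiteGauss k x).differentiableAt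

theorem continuous_hermiteGauss (k : ℕ) : Continuous (hermiteGauss k) :=
  (differentiable_hermiteGauss k).continuous

theorem integrable_polynomial_mul_exp_neg_mul_sq (P : Polynomial ℝ) {b : ℝ} (hb : 0 < b) :
    Integrable fun x : ℝ => P.eval x * Real.exp (-b * x ^ 2) := by
  induction P using Polynomial.induction_on' with
  | add p q hp hq => simp only [Polynomial.eval_add, add_mul]; exact hp.add hq
  | monomial n a =>
    have := (integrable_rpow_mul_exp_neg_mul_sq hb (s := n)
      (by have : (0 : ℝ) ≤ n := n.cast_nonneg
          linarith)).const_mul a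
    simpa [Polynomial.eval_monomial, mul_assoc] using this

theorem exists_polynomial_hermiteGauss (k : ℕ) : ∃ P : Polynomial ℝ, ∀ x,
    hermiteGauss k x = P.eval x * Real.exp (-x ^ 2 / 2) := by
  refine ⟨((Polynomial.hermite k).map (algebraMap ℤ ℝ)).comp
    (Polynomial.C (Real.sqrt 2) * Polynomial.X), fun x => ?_⟩
  simp [hermiteGauss, ← Polynomial.eval_map_algebraMap]

theorem integrable_hermiteGauss (k : ℕ) : Integrable (hermiteGauss k) := by
  obtain ⟨P, hP⟩ := exists_polynomial_hermiteGauss k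
  refine (integrable_polynomial_mul_exp_neg_mul_sq P (b := 1 / 2) (by norm_num)).congr
    (Filter.Eventually.of_forall fun x => ?_)
  simp only [hP]; congr 2; ring

theorem integrable_mul_hermiteGauss (k : ℕ) : Integrable fun x => x * hermiteGauss k x := by
  obtain ⟨P, hP⟩ := exists_polynomial_hermiteGauss k
  refine (integrable_polynomial_mul_exp_neg_mul_sq (Polynomial.X * P) (b := 1 / 2)
    (by norm_num)).congr (Filter.Eventually.of_forall fun x => ?_)
  simp only [hP, Polynomial.eval_mul, Polynomial.eval_X, mul_assoc]; congr 3; ring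

theorem integrable_hermiteGauss_mul (k l : ℕ) :
    Integrable fun x => hermiteGauss k x * hermiteGauss l x := by
  obtain ⟨P, hP⟩ := exists_polynomial_hermiteGauss k
  obtain ⟨Q, hQ⟩ := exists_polynomial_hermiteGauss l
  refine (integrable_polynomial_mul_exp_neg_mul_sq (P * Q) (b := 1) (by norm_num)).congr
    (Filter.Eventually.of_forall fun x => ?_)
  simp only [hP, hQ, Polynomial.eval_mul]
  rw [show -1 * x ^ 2 = -x ^ 2 / 2 + -x ^ 2 / 2 by ring, Real.exp_add]
  ring

/-- The derivative of `hermiteGauss k * hermiteGauss (k + 1)` integrates to zero; by the two ladder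
relations this is a recursion for the norms. -/
theorem integral_hermiteGauss_sq (k : ℕ) :
    ∫ x, hermiteGauss k x ^ 2 = k.factorial * Real.sqrt Real.pi := by
  induction k with
  | zero =>
    have := integral_gaussian 1
    simp only [div_one] at this
    rw [Nat.factorial_zero, Nat.cast_one, one_mul, ← this]
    congr 1; ext x
    simp only [hermiteGauss, Polynomial.hermite_zero, map_one, one_mul]
    rw [← Real.exp_nat_mul]; congr 1; push_cast; ring
  | succ k ih =>
    have h2 : (0 : ℝ) < Real.sqrt 2 := by positivity
    have hI1 : Integrable fun x => hermiteGauss k x ^ 2 := by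
      simpa [sq] using integrable_hermiteGauss_mul k k
    have hI2 : Integrable fun x => hermiteGauss (k + 1) x ^ 2 := by
      simpa [sq] using integrable_hermiteGauss_mul (k + 1) (k + 1)
    have hd : ∀ x, HasDerivAt (fun x => hermiteGauss k x * hermiteGauss (k + 1) x)
        (Real.sqrt 2 * ((k + 1) * hermiteGauss k x ^ 2 - hermiteGauss (k + 1) x ^ 2)) x := by
      intro x
      refine ((hasDerivAt_hermiteGauss k x).mul (hasDerivAt_hermiteGauss_succ k x)).congr_deriv ?_
      ring
    have h0 := integral_eq_zero_of_hasDerivAt_of_integrable hd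
      (((hI1.const_mul _).sub hI2).const_mul _) (integrable_hermiteGauss_mul k (k + 1))
    rw [integral_const_mul, integral_sub (hI1.const_mul _) hI2, integral_const_mul, ih] at h0
    have h1 := (mul_eq_zero.1 h0).resolve_left h2.ne'
    rw [Nat.factorial_succ]; push_cast
    linarith

theorem integral_hermiteFun_sq (k : ℕ) : ∫ x, hermiteFun k x ^ 2 = 1 := by
  simp only [hermiteFun_eq, mul_pow]
  rw [integral_const_mul, integral_hermiteGauss_sq, inv_pow, Real.sq_sqrt (by positivity)]
  field_simp

theorem continuous_hermiteFun (k : ℕ) : Continuous (hermiteFun k) := by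
  rw [funext (hermiteFun_eq k)]
  exact (continuous_hermiteGauss k).const_mul _

theorem integrable_hermiteFun (k : ℕ) : Integrable (hermiteFun k) := by
  rw [funext (hermiteFun_eq k)]
  exact (integrable_hermiteGauss k).const_mul _

theorem integrable_hermiteFun_sq (k : ℕ) : Integrable fun x => hermiteFun k x ^ 2 := by
  simp only [hermiteFun_eq, mul_pow]
  exact Integrable.const_mul (by simpa [sq] using integrable_hermiteGauss_mul k k) _

/-- The Hermite functions are uniformly integrable against a fixed Gaussian. -/
theorem integral_exp_mul_abs_hermiteFun_le {b : ℝ} (hb : 0 < b) (k : ℕ) :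
    Integrable (fun x => Real.exp (-b * x ^ 2) * |hermiteFun k x|) ∧
    ∫ x, Real.exp (-b * x ^ 2) * |hermiteFun k x| ≤ 1 + Real.sqrt (Real.pi / (2 * b)) := by
  have hI : Integrable fun x : ℝ => Real.exp (-(2 * b) * x ^ 2) + hermiteFun k x ^ 2 :=
    (integrable_exp_neg_mul_sq (by positivity)).add (integrable_hermiteFun_sq k)
  have hc := continuous_hermiteFun k
  -- By `uv ≤ u² + v²` only the `L²` norm of `hermiteFun k` enters, so the bound is independent of
  -- `k`.
  have hle : ∀ x, Real.exp (-b * x ^ 2) * |hermiteFun k x| ≤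
      Real.exp (-(2 * b) * x ^ 2) + hermiteFun k x ^ 2 := by
    intro x
    have h1 : Real.exp (-(2 * b) * x ^ 2) = Real.exp (-b * x ^ 2) ^ 2 := by
      rw [← Real.exp_nat_mul]; congr 1; push_cast; ring
    rw [h1, ← sq_abs (hermiteFun k x)]
    nlinarith [sq_nonneg (Real.exp (-b * x ^ 2) - |hermiteFun k x|),
      sq_nonneg (Real.exp (-b * x ^ 2)), sq_nonneg (|hermiteFun k x|)]
  have hI2 : Integrable (fun x => Real.exp (-b * x ^ 2) * |hermiteFun k x|) := by
    refine hI.mono' (by fun_prop) (Filter.Eventually.of_forall fun x => ?_)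
    rw [Real.norm_of_nonneg (by positivity)]
    exact hle x
  refine ⟨hI2, (integral_mono hI2 hI hle).trans_eq ?_⟩
  rw [integral_add (integrable_exp_neg_mul_sq (by positivity)) (integrable_hermiteFun_sq k),
    integral_gaussian, integral_hermiteFun_sq, add_comm]

/-- Induction by the raising relation: the Fourier transform exchanges differentiation and
multiplication by `x` up to constants, so raising contributes a factor `-i`. The argument `2πw`
reflects the kernel `e^{-2πixw}`. -/
theorem fourier_hermiteGauss (k : ℕ) (w : ℝ) : 𝓕 (fun x : ℝ => (hermiteGauss k x : ℂ)) w =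
    (Real.sqrt (2 * Real.pi) : ℂ) * (-Complex.I) ^ k * (hermiteGauss k (2 * Real.pi * w) : ℂ) := by
  induction k generalizing w with
  | zero =>
    have hpi := Real.pi_pos
    have h := congrFun (fourier_gaussian_pi (b := (((2 * Real.pi)⁻¹ : ℝ) : ℂ))
      (by rw [Complex.ofReal_re]; positivity)) w
    have e1 : (fun x : ℝ => (hermiteGauss 0 x : ℂ)) =
        fun x : ℝ => Complex.exp (-Real.pi * (((2 * Real.pi)⁻¹ : ℝ) : ℂ) * x ^ 2) := by
      ext x
      simp only [hermiteGauss, Polynomial.hermite_zero, map_one, one_mul]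
      push_cast; congr 1; field_simp
    rw [e1, h]
    have e2 : (((2 * Real.pi)⁻¹ : ℝ) : ℂ) ^ (1 / 2 : ℂ) = ((Real.sqrt (2 * Real.pi))⁻¹ : ℝ) := by
      rw [← Real.sqrt_inv, Real.sqrt_eq_rpow, Complex.ofReal_cpow (by positivity)]
      norm_num
    rw [e2]
    simp only [hermiteGauss, Polynomial.hermite_zero, map_one, one_mul, pow_zero, mul_one]
    push_cast
    rw [one_div, inv_inv]
    congr 2
    have : (Real.pi : ℂ) ≠ 0 := by exact_mod_cast hpi.ne'
    field_simp
  | succ k ih =>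
    set c : ℂ := (Real.sqrt (2 * Real.pi) : ℂ) * (-Complex.I) ^ k with hc
    have h2 : (Real.sqrt 2 : ℂ) * (Real.sqrt 2 : ℂ) = 2 := by
      rw [← Complex.ofReal_mul, Real.mul_self_sqrt (by norm_num)]; norm_num
    have h20 : (Real.sqrt 2 : ℂ) ≠ 0 := by
      intro h; rw [h] at h2; norm_num at h2
    have hpi : (Real.pi : ℂ) ≠ 0 := by exact_mod_cast Real.pi_ne_zero
    have hI0 : Integrable fun x : ℝ => (hermiteGauss k x : ℂ) := (integrable_hermiteGauss k).ofReal
    have hI1 : Integrable fun x : ℝ => ((x * hermiteGauss k x : ℝ) : ℂ) :=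
      (integrable_mul_hermiteGauss k).ofReal
    have hI2 : Integrable fun x : ℝ => (hermiteGauss (k + 1) x : ℂ) :=
      (integrable_hermiteGauss (k + 1)).ofReal
    have hd : ∀ x : ℝ, HasDerivAt (fun x : ℝ => (hermiteGauss k x : ℂ))
        ((x * hermiteGauss k x : ℝ) - (Real.sqrt 2 : ℂ) * (hermiteGauss (k + 1) x : ℂ)) x := by
      intro x
      refine (hasDerivAt_hermiteGauss k x).ofReal_comp.congr_deriv ?_
      push_cast; ring
    have hderiv : deriv (fun x : ℝ => (hermiteGauss k x : ℂ)) = fun x : ℝ =>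
        ((x * hermiteGauss k x : ℝ) : ℂ) - (Real.sqrt 2 : ℂ) * (hermiteGauss (k + 1) x : ℂ) :=
      funext fun x => (hd x).deriv
    have hA := congrFun (Real.fourier_deriv hI0 (fun x => (hd x).differentiableAt)
      (by rw [hderiv]; exact hI1.sub (hI2.const_mul _))) w
    have hlin : 𝓕 (deriv fun x : ℝ => (hermiteGauss k x : ℂ)) w =
        𝓕 (fun x : ℝ => ((x * hermiteGauss k x : ℝ) : ℂ)) w -
          (Real.sqrt 2 : ℂ) * 𝓕 (fun x : ℝ => (hermiteGauss (k + 1) x : ℂ)) w := by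
      rw [hderiv]
      simp only [Real.fourier_real_eq]
      rw [← integral_const_mul, ← integral_sub]
      · congr 1; ext x; simp only [Circle.smul_def, smul_eq_mul]; ring
      · exact (Real.fourierIntegral_convergent_iff (V := ℝ) w).2 hI1 |>.congr
          (Filter.Eventually.of_forall fun v => by simp [mul_comm w v])
      · exact (((Real.fourierIntegral_convergent_iff (V := ℝ) w).2 hI2).const_mul
          (Real.sqrt 2 : ℂ)).congr (Filter.Eventually.of_forall fun v => by simp [mul_comm w v])
    have hB := Real.hasDerivAt_fourier hI0 (by simpa using hI1) w
    have hB' : HasDerivAt (𝓕 fun x : ℝ => (hermiteGauss k x : ℂ))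
        (c * (2 * Real.pi * ((2 * Real.pi * w * hermiteGauss k (2 * Real.pi * w) : ℝ) -
          (Real.sqrt 2 : ℂ) * (hermiteGauss (k + 1) (2 * Real.pi * w) : ℂ)))) w := by
      rw [funext ih]
      have h1 : HasDerivAt (fun w : ℝ => 2 * Real.pi * w) (2 * Real.pi) w := by
        simpa using (hasDerivAt_id w).const_mul (2 * Real.pi)
      have := ((hd (2 * Real.pi * w)).scomp w h1).const_mul c
      refine this.congr_deriv ?_
      simp
    have hBe := hB.unique hB'
    have hBl : 𝓕 (fun x : ℝ => (-2 * Real.pi * Complex.I * x) • (hermiteGauss k x : ℂ)) w =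
        (-2 * Real.pi * Complex.I) * 𝓕 (fun x : ℝ => ((x * hermiteGauss k x : ℝ) : ℂ)) w := by
      simp only [Real.fourier_real_eq]
      rw [← integral_const_mul]
      congr 1; ext x; simp only [Circle.smul_def, smul_eq_mul]; push_cast; ring
    rw [hBl] at hBe
    rw [hlin, ih, smul_eq_mul] at hA
    set X := 𝓕 (fun x : ℝ => ((x * hermiteGauss k x : ℝ) : ℂ)) w
    set Y := 𝓕 (fun x : ℝ => (hermiteGauss (k + 1) x : ℂ)) w
    have hX : X = c * Complex.I * ((2 * Real.pi * w * hermiteGauss k (2 * Real.pi * w) : ℝ) -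
          (Real.sqrt 2 : ℂ) * (hermiteGauss (k + 1) (2 * Real.pi * w) : ℂ)) := by
      have hne : (-2 * Real.pi * Complex.I) ≠ 0 := by simp [hpi]
      apply mul_left_cancel₀ hne
      rw [hBe]
      linear_combination (-2 * Real.pi * c * ((2 * Real.pi * w * hermiteGauss k (2 * Real.pi * w) : ℝ) -
          (Real.sqrt 2 : ℂ) * (hermiteGauss (k + 1) (2 * Real.pi * w) : ℂ))) * -Complex.I_mul_I
    apply mul_left_cancel₀ h20
    rw [pow_succ]
    push_cast at hX hA ⊢
    linear_combination hX - hA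

/-! ### The Bargmann kernel. -/

/-- The generating function of the normalized Hermite functions: the Bargmann kernel. -/
noncomputable def bargmannKernel (z : ℂ) (s : ℝ) : ℂ :=
  ((Real.sqrt (Real.sqrt Real.pi))⁻¹ : ℝ) *
    Complex.exp (-(z ^ 2 + s ^ 2) / 2 + (Real.sqrt 2 : ℂ) * z * s)

/-- Only `z = 0` is used for the Taylor coefficients, but the induction needs every `z`. -/
theorem iteratedDeriv_exp_mul_sub (y : ℂ) (k : ℕ) :
    iteratedDeriv k (fun z : ℂ => Complex.exp (y * z - z ^ 2 / 2)) =
      fun z => Polynomial.aeval (y - z) (Polynomial.hermite k) * Complex.exp (y * z - z ^ 2 / 2) := by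
  induction k with
  | zero => ext z; simp
  | succ k ih =>
    ext z
    rw [iteratedDeriv_succ, ih]
    have h1 : HasDerivAt (fun z : ℂ => y - z) (-1) z := by
      simpa using (hasDerivAt_id z).const_sub y
    have h2 := ((Polynomial.hermite k).hasDerivAt_aeval (y - z)).comp z h1
    have h3 : HasDerivAt (fun z : ℂ => Complex.exp (y * z - z ^ 2 / 2))
        (Complex.exp (y * z - z ^ 2 / 2) * (y - z)) z := by
      refine HasDerivAt.congr_deriv
        ((((hasDerivAt_id z).const_mul y).sub (((hasDerivAt_id z).pow 2).div_const 2)).cexp) ?_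
      simp
    refine (h2.mul h3).deriv.trans ?_
    simp only [Function.comp, Polynomial.hermite_succ, map_sub, map_mul, Polynomial.aeval_X]
    ring

theorem hasSum_hermite (y z : ℂ) :
    HasSum (fun k : ℕ => Polynomial.aeval y (Polynomial.hermite k) / k.factorial * z ^ k)
      (Complex.exp (y * z - z ^ 2 / 2)) := by
  have hd : Differentiable ℂ fun z : ℂ => Complex.exp (y * z - z ^ 2 / 2) := by fun_prop
  refine (congrArg (fun f : ℕ → ℂ => HasSum f _) (funext fun k => ?_)).mp (Complex.hasSum_taylorSeries_of_entire hd 0 z)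
  rw [iteratedDeriv_exp_mul_sub]
  simp only [sub_zero, mul_zero, smul_eq_mul, ne_eq, OfNat.ofNat_ne_zero, not_false_eq_true,
    zero_pow, zero_div, Complex.exp_zero, mul_one]
  rw [div_eq_mul_inv]; ring

theorem hasSum_hermiteFun (z : ℂ) (s : ℝ) :
    HasSum (fun k : ℕ => z ^ k / (Real.sqrt k.factorial : ℂ) * (hermiteFun k s : ℂ))
      (bargmannKernel z s) := by
  have h := (hasSum_hermite ((Real.sqrt 2 * s : ℝ) : ℂ) z).mul_left
    (((Real.sqrt (Real.sqrt Real.pi))⁻¹ : ℝ) * Complex.exp (-s ^ 2 / 2))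
  have hB : bargmannKernel z s = ((Real.sqrt (Real.sqrt Real.pi))⁻¹ : ℝ) *
      Complex.exp (-s ^ 2 / 2) * Complex.exp (((Real.sqrt 2 * s : ℝ) : ℂ) * z - z ^ 2 / 2) := by
    rw [bargmannKernel, mul_assoc (((Real.sqrt (Real.sqrt Real.pi))⁻¹ : ℝ) : ℂ), ← Complex.exp_add]
    congr 2; push_cast; ring
  rw [hB]
  refine (congrArg (fun f : ℕ → ℂ => HasSum f _) (funext fun k => ?_)).mp h
  · have hc : Polynomial.aeval (((Real.sqrt 2 * s : ℝ) : ℂ)) (Polynomial.hermite k) =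
        ((Polynomial.aeval (Real.sqrt 2 * s) (Polynomial.hermite k) : ℝ) : ℂ) :=
      Polynomial.aeval_algebraMap_apply ℂ (Real.sqrt 2 * s) (Polynomial.hermite k)
    have hf : (k.factorial : ℂ) = (Real.sqrt k.factorial : ℂ) * (Real.sqrt k.factorial : ℂ) := by
      rw [← Complex.ofReal_mul, Real.mul_self_sqrt (by positivity)]; simp
    have hf0 : (Real.sqrt k.factorial : ℂ) ≠ 0 := by
      intro h0
      have := hf
      rw [h0, mul_zero] at this
      exact (Nat.factorial_ne_zero k) (by exact_mod_cast this)
    rw [hermiteFun, hc, hf, Real.sqrt_mul (by positivity)]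
    push_cast
    field_simp

theorem continuous_bargmannKernel (z : ℂ) : Continuous (bargmannKernel z) := by
  unfold bargmannKernel
  fun_prop

theorem norm_bargmannKernel (z : ℂ) (s : ℝ) : ‖bargmannKernel z s‖ =
    (Real.sqrt (Real.sqrt Real.pi))⁻¹ *
      Real.exp (-(z.re ^ 2 - z.im ^ 2 + s ^ 2) / 2 + Real.sqrt 2 * z.re * s) := by
  rw [bargmannKernel, norm_mul, Complex.norm_real, Real.norm_of_nonneg (by positivity),
    Complex.norm_exp]
  congr 2
  have h1 : (-(z ^ 2 + (s : ℂ) ^ 2) / 2 + (Real.sqrt 2 : ℂ) * z * s) =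
      (((-1 / 2 : ℝ) : ℂ) * (z ^ 2 + ((s ^ 2 : ℝ) : ℂ)) + ((Real.sqrt 2 * s : ℝ) : ℂ) * z) := by
    push_cast; ring
  rw [h1, Complex.add_re, Complex.re_ofReal_mul, Complex.re_ofReal_mul, Complex.add_re,
    Complex.ofReal_re, sq z, Complex.mul_re]
  ring

/-- The integrand is a Gaussian in `s` centred at `m`. Completing the square leaves `(1/β - 1) x²/2`
with `β = b + 1/2`, the source of the ratio `(1 - 2b)/(1 + 2b)`. -/
theorem integral_exp_mul_norm_bargmannKernel {b : ℝ} (hb : 0 < b) (z : ℂ) :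
    Integrable (fun s => Real.exp (-b * s ^ 2) * ‖bargmannKernel z s‖) ∧
    ∫ s, Real.exp (-b * s ^ 2) * ‖bargmannKernel z s‖ =
      (Real.sqrt (Real.sqrt Real.pi))⁻¹ * Real.sqrt (Real.pi / (b + 1 / 2)) *
        Real.exp (z.im ^ 2 / 2 + (1 - 2 * b) / (1 + 2 * b) * z.re ^ 2 / 2) := by
  set β := b + 1 / 2 with hβ
  have hβ0 : 0 < β := by positivity
  set m := z.re / (Real.sqrt 2 * β) with hm
  have h2 := Real.mul_self_sqrt (show (0 : ℝ) ≤ 2 by norm_num)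
  have h20 : Real.sqrt 2 ≠ 0 := by positivity
  have key : (fun s => Real.exp (-b * s ^ 2) * ‖bargmannKernel z s‖) = fun s =>
      ((Real.sqrt (Real.sqrt Real.pi))⁻¹ *
        Real.exp (z.im ^ 2 / 2 + (1 - 2 * b) / (1 + 2 * b) * z.re ^ 2 / 2)) *
      Real.exp (-β * (s - m) ^ 2) := by
    ext s
    rw [norm_bargmannKernel, mul_left_comm, mul_assoc, mul_assoc, ← Real.exp_add, ← Real.exp_add]
    congr 2
    have e1 : (1 - 2 * b) / (1 + 2 * b) = (1 / β - 1) := by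
      rw [hβ]; field_simp; ring
    have e2 : β * m ^ 2 = z.re ^ 2 / (2 * β) := by
      rw [hm, div_pow, mul_pow, sq (Real.sqrt 2), h2]; field_simp
    have e3 : β * m = z.re * Real.sqrt 2 / 2 := by
      rw [hm]; field_simp; rw [sq, h2]
    have e4 : -β * (s - m) ^ 2 = -β * s ^ 2 + 2 * s * (β * m) - β * m ^ 2 := by ring
    rw [e4, e1, e2, e3, hβ]
    field_simp
    ring
  rw [key]
  constructor
  · exact ((integrable_exp_neg_mul_sq hβ0).comp_sub_right m).const_mul _
  · rw [integral_const_mul, integral_sub_right_eq_self (fun s => Real.exp (-β * s ^ 2)) m,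
      integral_gaussian]
    ring

/-! ### Product functions on `ℝⁿ` and Fourier duality in `L²`. -/

variable {n : ℕ}

theorem integral_euclidean_prod {𝕜 : Type*} [RCLike 𝕜] (f : Fin n → ℝ → 𝕜) :
    ∫ x : EuclideanSpace ℝ (Fin n), ∏ i, f i (x i) = ∏ i, ∫ s, f i s := by
  rw [← (PiLp.volume_preserving_toLp (Fin n)).integral_comp
    (MeasurableEquiv.toLp 2 _).measurableEmbedding]
  exact integral_fintype_prod_volume_eq_prod f

theorem integrable_euclidean_prod {𝕜 : Type*} [RCLike 𝕜] {f : Fin n → ℝ → 𝕜}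
    (hf : ∀ i, Integrable (f i)) :
    Integrable fun x : EuclideanSpace ℝ (Fin n) => ∏ i, f i (x i) := by
  rw [← (PiLp.volume_preserving_toLp (Fin n)).integrable_comp_emb
    (MeasurableEquiv.toLp 2 _).measurableEmbedding]
  exact Integrable.fintype_prod hf

theorem exp_neg_mul_norm_sq_eq_prod (b : ℝ) (x : EuclideanSpace ℝ (Fin n)) :
    Real.exp (-b * ‖x‖ ^ 2) = ∏ i, Real.exp (-b * x i ^ 2) := by
  rw [EuclideanSpace.norm_sq_eq, Finset.mul_sum, Real.exp_sum]
  simp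

/-- Integration of a function with Gaussian decay against a product of one-variable functions. -/
theorem integral_mul_prod_le {g : EuclideanSpace ℝ (Fin n) → ℂ} (hg : AEStronglyMeasurable g)
    {C b : ℝ} (hgC : ∀ᵐ x, ‖g x‖ ≤ C * Real.exp (-b * ‖x‖ ^ 2)) {w : Fin n → ℝ → ℂ}
    (hw : ∀ i, Continuous (w i))
    (hwi : ∀ i, Integrable fun s => Real.exp (-b * s ^ 2) * ‖w i s‖) :
    Integrable (fun x => g x * ∏ i, w i (x i)) ∧
    ∫ x, ‖g x * ∏ i, w i (x i)‖ ≤ C * ∏ i, ∫ s, Real.exp (-b * s ^ 2) * ‖w i s‖ := by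
  have hI := (integrable_euclidean_prod hwi).const_mul C
  have hle : ∀ᵐ x, ‖g x * ∏ i, w i (x i)‖ ≤ C * ∏ i, (Real.exp (-b * x i ^ 2) * ‖w i (x i)‖) := by
    filter_upwards [hgC] with x hx
    rw [norm_mul, norm_prod, Finset.prod_mul_distrib, ← exp_neg_mul_norm_sq_eq_prod, ← mul_assoc]
    gcongr
  have hcont : Continuous fun x : EuclideanSpace ℝ (Fin n) => ∏ i, w i (x i) :=
    continuous_finsetProd _ fun i _ => (hw i).comp (by fun_prop)
  have hint : Integrable (fun x => g x * ∏ i, w i (x i)) :=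
    hI.mono' (hg.mul hcont.aestronglyMeasurable) hle
  refine ⟨hint, (integral_mono_ae hint.norm hI hle).trans_eq ?_⟩
  rw [integral_const_mul, integral_euclidean_prod fun i s => Real.exp (-b * s ^ 2) * ‖w i s‖]

/-- For Schwartz functions this is Fubini. Both sides are `L²` inner products with a fixed function,
hence continuous in `ψ`, and Schwartz functions are dense. -/
theorem integral_fourier_mul_of_memLp {V : Type*} [NormedAddCommGroup V] [InnerProductSpace ℝ V]
    [FiniteDimensional ℝ V] [MeasurableSpace V] [BorelSpace V] {W : V → ℂ} (hW : Integrable W)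
    (hW2 : MemLp W 2) (hW' : MemLp (𝓕 W) 2) (ψ : Lp ℂ 2 (volume : Measure V)) :
    ∫ x, (𝓕 ψ : Lp ℂ 2 (volume : Measure V)) x * W x = ∫ x, ψ x * 𝓕 W x := by
  have hinner : ∀ {U : V → ℂ} (hU : MemLp U 2) (φ : Lp ℂ 2 (volume : Measure V)),
      ∫ x, φ x * U x = inner ℂ (hU.star.toLp (star U)) φ := by
    intro U hU φ
    rw [L2.inner_def]
    refine integral_congr_ae ?_
    filter_upwards [hU.star.coeFn_toLp] with x hx
    rw [hx]
    simp [RCLike.inner_apply]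
  have hc : ∀ {U : V → ℂ}, MemLp U 2 →
      Continuous fun φ : Lp ℂ 2 (volume : Measure V) => ∫ x, φ x * U x := by
    intro U hU
    simp only [hinner hU]
    fun_prop
  have hS : ∀ f : SchwartzMap V ℂ,
      ∫ x, (𝓕 (f.toLp 2 volume) : Lp ℂ 2 (volume : Measure V)) x * W x =
        ∫ x, (f.toLp 2 volume) x * 𝓕 W x := by
    intro f
    have h1 : ∫ x, (𝓕 (f.toLp 2 volume) : Lp ℂ 2 (volume : Measure V)) x * W x =
        ∫ x, 𝓕 (f : V → ℂ) x * W x := by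
      rw [SchwartzMap.toLp_fourier_eq]
      refine integral_congr_ae ?_
      filter_upwards [(𝓕 f).coeFn_toLp 2 volume] with x hx
      rw [hx, SchwartzMap.fourier_coe]
    have h2 : ∫ x, (f.toLp 2 volume) x * 𝓕 W x = ∫ x, f x * 𝓕 W x := by
      refine integral_congr_ae ?_
      filter_upwards [f.coeFn_toLp 2 volume] with x hx
      rw [hx]
    rw [h1, h2]
    have := VectorFourier.integral_fourierIntegral_smul_eq_flip (L := innerₗ V)
      Real.continuous_fourierChar continuous_inner (f.integrable (μ := volume)) hW
    rw [flip_innerₗ] at this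
    exact this
  have hdense : DenseRange (SchwartzMap.toLpCLM ℝ (E := V) ℂ 2 (volume : Measure V)) :=
    SchwartzMap.denseRange_toLpCLM ENNReal.ofNat_ne_top
  refine DenseRange.induction_on
    (p := fun ψ : Lp ℂ 2 (volume : Measure V) =>
      ∫ x, (𝓕 ψ : Lp ℂ 2 (volume : Measure V)) x * W x = ∫ x, ψ x * 𝓕 W x)
    hdense ψ ?_ ?_
  · exact isClosed_eq ((hc hW2).comp (Lp.fourierTransformₗᵢ V ℂ).continuous) (hc hW')
  · intro f
    exact hS f

/-- The dilation by `2π` is the one that arises when `𝓕 ψ (ξ / 2π)` is paired with a Hermite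
function of `ξ`. -/
theorem fourier_hermiteFun_scaled (k : ℕ) (w : ℝ) :
    𝓕 (fun x : ℝ => (hermiteFun k (2 * Real.pi * x) : ℂ)) w =
      ((Real.sqrt (2 * Real.pi))⁻¹ : ℝ) * (-Complex.I) ^ k * (hermiteFun k w : ℂ) := by
  have hpi : (0 : ℝ) < 2 * Real.pi := by positivity
  have h := fourier_hermiteGauss k (w / (2 * Real.pi))
  rw [mul_div_cancel₀ _ hpi.ne', Real.fourier_real_eq_integral_exp_smul] at h
  have hs := Measure.integral_comp_mul_left (fun v : ℝ =>
    Complex.exp (↑(-2 * Real.pi * v * (w / (2 * Real.pi))) * Complex.I) • (hermiteGauss k v : ℂ))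
    (2 * Real.pi)
  rw [h, abs_of_pos (inv_pos.2 hpi)] at hs
  rw [Real.fourier_real_eq_integral_exp_smul]
  have e : ∀ v : ℝ, Complex.exp (↑(-2 * Real.pi * v * w) * Complex.I) •
      (hermiteFun k (2 * Real.pi * v) : ℂ) =
      (((Real.sqrt (k.factorial * Real.sqrt Real.pi))⁻¹ : ℝ) : ℂ) *
      (Complex.exp (↑(-2 * Real.pi * (2 * Real.pi * v) * (w / (2 * Real.pi))) * Complex.I) •
        (hermiteGauss k (2 * Real.pi * v) : ℂ)) := by
    intro v
    have : -2 * Real.pi * (2 * Real.pi * v) * (w / (2 * Real.pi)) = -2 * Real.pi * v * w := by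
      field_simp
    rw [this, hermiteFun_eq, smul_eq_mul, smul_eq_mul]
    push_cast; ring
  simp only [e]
  rw [integral_const_mul, hs, hermiteFun_eq, Complex.real_smul]
  have hr : (((2 * Real.pi)⁻¹ : ℝ) : ℂ) * (Real.sqrt (2 * Real.pi) : ℂ) =
      (((Real.sqrt (2 * Real.pi))⁻¹ : ℝ) : ℂ) := by
    rw [← Complex.ofReal_mul]
    congr 1
    nth_rw 1 [← Real.mul_self_sqrt hpi.le]
    have : Real.sqrt (2 * Real.pi) ≠ 0 := by positivity
    field_simp
  rw [← hr]
  push_cast; ring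

theorem fourier_prod (f : Fin n → ℝ → ℂ) (x : EuclideanSpace ℝ (Fin n)) :
    𝓕 (fun v : EuclideanSpace ℝ (Fin n) => ∏ i, f i (v i)) x = ∏ i, 𝓕 (f i) (x i) := by
  simp only [Real.fourier_real_eq_integral_exp_smul]
  rw [Real.fourier_eq', ← integral_euclidean_prod fun i s =>
    Complex.exp (↑(-2 * Real.pi * s * x i) * Complex.I) • f i s]
  congr 1; ext v
  simp only [smul_eq_mul]
  rw [Finset.prod_mul_distrib, ← Complex.exp_sum, ← Finset.sum_mul, ← Complex.ofReal_sum]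
  congr 4
  rw [PiLp.inner_apply, Finset.mul_sum]
  refine Finset.sum_congr rfl fun i _ => ?_
  simp; ring

theorem prod_update_apply {M : Type*} [CommMonoid M] (f : Fin n → ℝ → M) (j : Fin n) (v : ℝ → M)
    (x : Fin n → ℝ) : ∏ i, Function.update f j v i (x i) =
      v (x j) * ∏ i ∈ Finset.univ.erase j, f i (x i) := by
  rw [← Finset.mul_prod_erase Finset.univ _ (Finset.mem_univ j), Function.update_self]
  congr 1
  refine Finset.prod_congr rfl fun i hi => ?_
  rw [Function.update_of_ne (Finset.ne_of_mem_erase hi)]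

theorem ofReal_hermiteFunMulti (α : Fin n → ℕ) (x : EuclideanSpace ℝ (Fin n)) :
    (hermiteFunMulti α x : ℂ) = ∏ i, (hermiteFun (α i) (x i) : ℂ) := by
  rw [hermiteFunMulti]; push_cast; rfl

theorem ofReal_hermiteFunMulti_update (α : Fin n → ℕ) (j : Fin n) (k : ℕ)
    (x : EuclideanSpace ℝ (Fin n)) : (hermiteFunMulti (Function.update α j k) x : ℂ) =
      hermiteFun k (x j) * ∏ i ∈ Finset.univ.erase j, (hermiteFun (α i) (x i) : ℂ) := by
  rw [ofReal_hermiteFunMulti, ← Finset.mul_prod_erase Finset.univ _ (Finset.mem_univ j),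
    Function.update_self]
  congr 1
  refine Finset.prod_congr rfl fun i hi => ?_
  rw [Function.update_of_ne (Finset.ne_of_mem_erase hi)]

/-- The square of each term is `(2x²)^k / k!` times `2^{-k}`, so the term is at most the sum of
these two summable factors. -/
theorem summable_pow_div_sqrt_factorial (x : ℝ) :
    Summable fun k : ℕ => |x| ^ k / Real.sqrt k.factorial := by
  have hs := ((Real.summable_pow_div_factorial (2 * x ^ 2)).add
    (summable_geometric_of_lt_one (r := (1 / 2 : ℝ)) (by norm_num) (by norm_num)))
  refine Summable.of_nonneg_of_le (fun k => by positivity) (fun k => ?_) hs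
  have hf : (0 : ℝ) < k.factorial := by positivity
  have h1 : (|x| ^ k / Real.sqrt k.factorial) ^ 2 =
      (2 * x ^ 2) ^ k / k.factorial * (1 / 2) ^ k := by
    rw [div_pow, Real.sq_sqrt hf.le, ← pow_mul, mul_comm k 2, pow_mul, sq_abs, div_mul_eq_mul_div,
      ← mul_pow]
    congr 2; ring
  have hA : 0 ≤ (2 * x ^ 2) ^ k / (k.factorial : ℝ) := by positivity
  have hB : (0 : ℝ) ≤ (1 / 2) ^ k := by positivity
  refine (sq_le_sq₀ (by positivity) (by positivity)).1 ?_
  rw [h1]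
  nlinarith

/-! ### Bargmann transforms of Hermite coefficients, and the Fourier rotation. -/

/-- The power series in one index of the Hermite coefficients of a function with Gaussian decay
converges to a Bargmann transform, which inherits Gaussian bounds. -/
theorem exists_hasSum_hermite_coeff {g : EuclideanSpace ℝ (Fin n) → ℂ}
    (hg : AEStronglyMeasurable g) {C b : ℝ} (hC : 0 ≤ C) (hb : 0 < b)
    (hgC : ∀ᵐ x, ‖g x‖ ≤ C * Real.exp (-b * ‖x‖ ^ 2)) (α : Fin n → ℕ) (j : Fin n) (z : ℂ) :
    ∃ F : ℂ, HasSum (fun k : ℕ => (∫ x, g x * (hermiteFunMulti (Function.update α j k) x : ℂ)) /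
        (Real.sqrt k.factorial : ℂ) * z ^ k) F ∧
      ‖F‖ ≤ C * (1 + Real.sqrt (Real.pi / (2 * b))) ^ (n - 1) *
        ((Real.sqrt (Real.sqrt Real.pi))⁻¹ * Real.sqrt (Real.pi / (b + 1 / 2))) *
        Real.exp (z.im ^ 2 / 2 + (1 - 2 * b) / (1 + 2 * b) * z.re ^ 2 / 2) := by
  set L := 1 + Real.sqrt (Real.pi / (2 * b)) with hL
  have hL0 : 0 ≤ L := by positivity
  have hnorm : ∀ k : ℕ, (fun s => Real.exp (-b * s ^ 2) * ‖(hermiteFun k s : ℂ)‖) =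
      fun s => Real.exp (-b * s ^ 2) * |hermiteFun k s| := fun k => by
    ext s; rw [Complex.norm_real, Real.norm_eq_abs]
  have hcoef : ∀ k : ℕ,
      Integrable (fun x => g x * (hermiteFunMulti (Function.update α j k) x : ℂ)) ∧
      ∫ x, ‖g x * (hermiteFunMulti (Function.update α j k) x : ℂ)‖ ≤ C * L ^ n := by
    intro k
    have := integral_mul_prod_le hg hgC
      (w := fun i s => (hermiteFun (Function.update α j k i) s : ℂ))
      (fun i => Complex.continuous_ofReal.comp (continuous_hermiteFun _))
      (fun i => by rw [hnorm]; exact (integral_exp_mul_abs_hermiteFun_le hb _).1)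
    simp only [← ofReal_hermiteFunMulti] at this
    refine ⟨this.1, this.2.trans ?_⟩
    refine mul_le_mul_of_nonneg_left ?_ hC
    calc _ ≤ ∏ _i : Fin n, L := by
          refine Finset.prod_le_prod (fun i _ => integral_nonneg fun s => by positivity)
            fun i _ => ?_
          rw [hnorm]; exact (integral_exp_mul_abs_hermiteFun_le hb _).2
      _ = L ^ n := by simp
  let W : Fin n → ℝ → ℂ :=
    Function.update (fun i s => (hermiteFun (α i) s : ℂ)) j (bargmannKernel z)
  refine ⟨∫ x, g x * ∏ i, W i (x i), ?_, ?_⟩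
  -- Sum and integral may be exchanged because the `L¹` norms in `hcoef` are at most `C * L ^ n` for
  -- all `k`.
  · have hsum := hasSum_integral_of_summable_integral_norm (μ := volume)
      (F := fun (k : ℕ) x => (z ^ k / (Real.sqrt k.factorial : ℂ)) *
        (g x * (hermiteFunMulti (Function.update α j k) x : ℂ)))
      (fun k => (hcoef k).1.const_mul _) ?_
    · have h1 : ∀ x, ∑' k : ℕ, (z ^ k / (Real.sqrt k.factorial : ℂ)) *
          (g x * (hermiteFunMulti (Function.update α j k) x : ℂ)) = g x * ∏ i, W i (x i) := by
        intro x
        rw [prod_update_apply]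
        have := (hasSum_hermiteFun z (x j)).mul_right
          (g x * ∏ i ∈ Finset.univ.erase j, (hermiteFun (α i) (x i) : ℂ))
        rw [mul_left_comm, ← this.tsum_eq]
        congr 1; ext k
        rw [ofReal_hermiteFunMulti_update]; ring
      simp only [h1, integral_const_mul] at hsum
      refine (congrArg (fun f : ℕ → ℂ => HasSum f _) (funext fun k => ?_)).mp hsum
      ring
    · refine Summable.of_nonneg_of_le (fun k => integral_nonneg fun x => norm_nonneg _)
        (fun k => ?_) ((summable_pow_div_sqrt_factorial ‖z‖).mul_right (C * L ^ n))
      simp only [norm_mul (z ^ k / _)]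
      rw [integral_const_mul, norm_div, norm_pow, Complex.norm_real,
        Real.norm_of_nonneg (Real.sqrt_nonneg _), abs_norm]
      exact mul_le_mul_of_nonneg_left (hcoef k).2 (by positivity)
  · have hW : ∀ i, Continuous (W i) := by
      intro i
      by_cases hi : i = j
      · subst hi; simpa [W] using continuous_bargmannKernel z
      · simp only [W, Function.update_of_ne hi]
        exact Complex.continuous_ofReal.comp (continuous_hermiteFun (α i))
    have hWi : ∀ i, Integrable fun s => Real.exp (-b * s ^ 2) * ‖W i s‖ := by
      intro i
      by_cases hi : i = j
      · subst hi; simpa [W] using (integral_exp_mul_norm_bargmannKernel hb z).1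
      · simpa [W, hi] using (integral_exp_mul_abs_hermiteFun_le hb (α i)).1
    have hle := (integral_mul_prod_le hg hgC hW hWi).2
    refine (norm_integral_le_integral_norm _).trans (hle.trans ?_)
    rw [← Finset.mul_prod_erase Finset.univ _ (Finset.mem_univ j)]
    have hj := (integral_exp_mul_norm_bargmannKernel hb z).2
    rw [← show W j = bargmannKernel z from Function.update_self ..] at hj
    have hrest : ∏ i ∈ Finset.univ.erase j, ∫ s, Real.exp (-b * s ^ 2) * ‖W i s‖ ≤ L ^ (n - 1) := by
      calc _ ≤ ∏ _i ∈ Finset.univ.erase j, L := by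
            refine Finset.prod_le_prod (fun i _ => integral_nonneg fun s => by positivity)
              fun i hi => ?_
            simp only [W, Function.update_of_ne (Finset.ne_of_mem_erase hi)]
            rw [hnorm]; exact (integral_exp_mul_abs_hermiteFun_le hb _).2
        _ = L ^ (n - 1) := by simp
    rw [hj]
    calc _ ≤ C * ((Real.sqrt (Real.sqrt Real.pi))⁻¹ * Real.sqrt (Real.pi / (b + 1 / 2)) *
          Real.exp (z.im ^ 2 / 2 + (1 - 2 * b) / (1 + 2 * b) * z.re ^ 2 / 2) * L ^ (n - 1)) := by
          gcongr
      _ = _ := by ring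

theorem stronglyMeasurable_unitaryFourier
    (ψ : Lp ℂ 2 (volume : Measure (EuclideanSpace ℝ (Fin n)))) :
    StronglyMeasurable (unitaryFourier ψ) :=
  ((Lp.stronglyMeasurable _).comp_measurable (measurable_const_smul _)).const_mul _

/-- Hermite functions are eigenfunctions of the Fourier transform, tested against `L²`. -/
theorem integral_unitaryFourier_mul_hermiteFunMulti
    (ψ : Lp ℂ 2 (volume : Measure (EuclideanSpace ℝ (Fin n)))) (α : Fin n → ℕ) :
    ∫ ξ, unitaryFourier ψ ξ * (hermiteFunMulti α ξ : ℂ) =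
      (-Complex.I) ^ (∑ i, α i) * hermiteCoeff ψ α := by
  have hpi : (0 : ℝ) < 2 * Real.pi := by positivity
  set W : EuclideanSpace ℝ (Fin n) → ℂ := fun v => ∏ i, (hermiteFun (α i) (2 * Real.pi * v i) : ℂ)
    with hWdef
  set c : ℂ := ((Real.sqrt (2 * Real.pi))⁻¹ : ℝ) ^ n with hc
  have hFW : 𝓕 W = fun x => c * (-Complex.I) ^ (∑ i, α i) * (hermiteFunMulti α x : ℂ) := by
    ext x
    rw [hWdef, fourier_prod fun i s => (hermiteFun (α i) (2 * Real.pi * s) : ℂ)]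
    simp only [fourier_hermiteFun_scaled]
    rw [Finset.prod_mul_distrib, Finset.prod_mul_distrib, ofReal_hermiteFunMulti,
      Finset.prod_pow_eq_pow_sum]
    simp [hc]
  have hi : ∀ k, Integrable fun s : ℝ => (hermiteFun k (2 * Real.pi * s) : ℂ) := fun k =>
    ((integrable_hermiteFun k).comp_mul_left' hpi.ne').ofReal
  have hW1 : Integrable W := integrable_euclidean_prod fun i => hi (α i)
  have hWc : Continuous W := continuous_finsetProd _ fun i _ =>
    Complex.continuous_ofReal.comp ((continuous_hermiteFun _).comp (by fun_prop))
  have hΦc : Continuous fun x : EuclideanSpace ℝ (Fin n) => (hermiteFunMulti α x : ℂ) := by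
    simp only [ofReal_hermiteFunMulti]
    exact continuous_finsetProd _ fun i _ =>
      Complex.continuous_ofReal.comp ((continuous_hermiteFun _).comp (by fun_prop))
  have hW2 : MemLp W 2 := by
    rw [memLp_two_iff_integrable_sq_norm hWc.aestronglyMeasurable]
    have : Integrable fun v : EuclideanSpace ℝ (Fin n) =>
        ∏ i, hermiteFun (α i) (2 * Real.pi * v i) ^ 2 :=
      integrable_euclidean_prod (f := fun i s => hermiteFun (α i) (2 * Real.pi * s) ^ 2)
        fun i => (integrable_hermiteFun_sq (α i)).comp_mul_left' hpi.ne'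
    refine this.congr (Filter.Eventually.of_forall fun v => ?_)
    simp [hWdef, norm_prod, Finset.prod_pow, ← Finset.abs_prod]
  have hΦ2 : MemLp (fun x : EuclideanSpace ℝ (Fin n) => (hermiteFunMulti α x : ℂ)) 2 := by
    rw [memLp_two_iff_integrable_sq_norm hΦc.aestronglyMeasurable]
    have : Integrable fun v : EuclideanSpace ℝ (Fin n) => ∏ i, hermiteFun (α i) (v i) ^ 2 :=
      integrable_euclidean_prod fun i => integrable_hermiteFun_sq (α i)
    refine this.congr (Filter.Eventually.of_forall fun v => ?_)
    simp [hermiteFunMulti, Finset.prod_pow, ← Finset.abs_prod]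
  have key := integral_fourier_mul_of_memLp hW1 hW2 (by rw [hFW]; exact hΦ2.const_mul _) ψ
  have hΦW : ∀ ξ : EuclideanSpace ℝ (Fin n),
      (hermiteFunMulti α ξ : ℂ) = W ((2 * Real.pi)⁻¹ • ξ) := by
    intro ξ
    rw [ofReal_hermiteFunMulti, hWdef]
    refine Finset.prod_congr rfl fun i _ => ?_
    rw [PiLp.smul_apply, smul_eq_mul, mul_inv_cancel_left₀ hpi.ne']
  have hsc := Measure.integral_comp_smul (volume : Measure (EuclideanSpace ℝ (Fin n)))
    (fun η => (𝓕 ψ : Lp ℂ 2 (volume : Measure (EuclideanSpace ℝ (Fin n)))) η * W η) (2 * Real.pi)⁻¹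
  rw [key, finrank_euclideanSpace_fin, inv_pow, inv_inv, abs_of_pos (by positivity)] at hsc
  simp only [unitaryFourier, mul_assoc, hΦW]
  rw [integral_const_mul, hsc, hFW, hermiteCoeff]
  have e1 : ∀ x, ψ x * (c * (-Complex.I) ^ (∑ i, α i) * (hermiteFunMulti α x : ℂ)) =
      (c * (-Complex.I) ^ (∑ i, α i)) * (ψ x * (hermiteFunMulti α x : ℂ)) := fun x => by ring
  simp only [e1]
  rw [integral_const_mul, Complex.real_smul]
  -- Unitary normalization `(2π)^{-n/2}`, Jacobian `(2π)^n` and the scaled Hermite factor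
  -- `(2π)^{-n/2}` cancel.
  have e2 : (((2 * Real.pi) ^ (-(n : ℝ) / 2) : ℝ) : ℂ) * ((((2 * Real.pi) ^ n : ℝ) : ℂ) * c) = 1 := by
    rw [hc, ← Complex.ofReal_pow, ← Complex.ofReal_mul, ← Complex.ofReal_mul,
      ← Complex.ofReal_one]
    congr 1
    rw [inv_pow, Real.sqrt_eq_rpow, ← Real.rpow_natCast, ← Real.rpow_natCast _ n,
      ← Real.rpow_mul hpi.le, ← Real.rpow_neg hpi.le, ← Real.rpow_add hpi, ← Real.rpow_add hpi]
    rw [show -(n : ℝ) / 2 + (n + -(1 / 2 * (n : ℝ))) = 0 by ring, Real.rpow_zero]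
  linear_combination ((-Complex.I) ^ (∑ i, α i) * ∫ x, ψ x * (hermiteFunMulti α x : ℂ)) * e2

/-! ### The one-index bound and the geometric mean. -/

theorem tanh_ratio (s : ℝ) :
    (1 - Real.tanh s) / (1 + Real.tanh s) = Real.exp (-2 * s) := by
  have hc := Real.cosh_pos s
  have h1 : 1 - Real.tanh s = Real.exp (-s) / Real.cosh s := by
    rw [Real.tanh_eq_sinh_div_cosh, ← Real.cosh_sub_sinh]; field_simp
  have h2 : 1 + Real.tanh s = Real.exp s / Real.cosh s := by
    rw [Real.tanh_eq_sinh_div_cosh, ← Real.cosh_add_sinh]; field_simp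
  rw [h1, h2, div_div_div_cancel_right₀ hc.ne', ← Real.exp_sub]
  congr 1; ring

/-- The one-index coefficient bound, uniform in the other indices. -/
theorem exists_norm_hermiteCoeff_le (n : ℕ) {t : ℝ} (ht : 0 < t) :
    ∃ K : ℝ, 0 ≤ K ∧ ∀ (C : ℝ) (ψ : Lp ℂ 2 (volume : Measure (EuclideanSpace ℝ (Fin n)))),
      0 ≤ C →
      (∀ᵐ x, ‖ψ x‖ ≤ C * Real.exp (-(Real.tanh (2 * t) / 2) * ‖x‖ ^ 2)) →
      (∀ᵐ ξ, ‖unitaryFourier ψ ξ‖ ≤ C * Real.exp (-(Real.tanh (2 * t) / 2) * ‖ξ‖ ^ 2)) →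
      ∀ (α : Fin n → ℕ) (j : Fin n), ‖hermiteCoeff ψ α‖ ≤
        K * C * (2 * (α j : ℝ) + 1) ^ (-(1 / 4) : ℝ) *
          Real.exp (-((2 * (α j : ℝ) + 1) * t / 2)) := by
  obtain ⟨K, hK, H⟩ := exists_norm_coeff_le ht
  set b := Real.tanh (2 * t) / 2 with hbdef
  have hb : 0 < b := by
    have : 0 < Real.tanh (2 * t) := by
      rw [Real.tanh_eq_sinh_div_cosh]
      exact div_pos (Real.sinh_pos_iff.2 (by linarith)) (Real.cosh_pos _)
    positivity
  have hε : (1 - 2 * b) / (1 + 2 * b) = Real.exp (-4 * t) := by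
    rw [hbdef, mul_div_cancel₀ _ two_ne_zero, tanh_ratio]; congr 1; ring
  set B := (1 + Real.sqrt (Real.pi / (2 * b))) ^ (n - 1) *
    ((Real.sqrt (Real.sqrt Real.pi))⁻¹ * Real.sqrt (Real.pi / (b + 1 / 2))) with hB
  have hB0 : 0 ≤ B := by positivity
  refine ⟨K * B, by positivity, fun C ψ hC h1 h2 α j => ?_⟩
  have hF := exists_hasSum_hermite_coeff (Lp.aestronglyMeasurable ψ) hC hb h1 α j
  have hG := exists_hasSum_hermite_coeff (stronglyMeasurable_unitaryFourier ψ).aestronglyMeasurable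
    hC hb h2 α j
  rw [hε] at hF hG
  choose F hFs hFn using hF
  choose G hGs hGn using hG
  -- The `k`-th coefficient of `G` carries `(-i)^{k+S}` and `(-i)^k i^k = 1`, so `G (iz) = (-i)^S F
  -- z`. Since `z ↦ iz` exchanges `(Re z)²` and `(Im z)²`, the bound on `G` is the second axis bound
  -- on `F`.
  have hFG : ∀ z, ‖F z‖ = ‖G (Complex.I * z)‖ := by
    intro z
    set S := ∑ i ∈ Finset.univ.erase j, α i with hS
    have hsum : ∀ k, ∑ i, Function.update α j k i = k + S := by
      intro k
      rw [← Finset.add_sum_erase Finset.univ _ (Finset.mem_univ j), Function.update_self]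
      congr 1
      exact Finset.sum_congr rfl fun i hi => by
        rw [Function.update_of_ne (Finset.ne_of_mem_erase hi)]
    have h3 : HasSum (fun k : ℕ => (-Complex.I) ^ S * (hermiteCoeff ψ (Function.update α j k) /
        (Real.sqrt k.factorial : ℂ) * z ^ k)) (G (Complex.I * z)) := by
      refine (congrArg (fun f : ℕ → ℂ => HasSum f _) (funext fun k => ?_)).mp
        (hGs (Complex.I * z))
      rw [integral_unitaryFourier_mul_hermiteFunMulti, hsum, pow_add, mul_pow]
      have : (-Complex.I) ^ k * Complex.I ^ k = 1 := by
        rw [← mul_pow]; simp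
      linear_combination ((-Complex.I) ^ S * (hermiteCoeff ψ (Function.update α j k) /
        (Real.sqrt k.factorial : ℂ) * z ^ k)) * this
    rw [h3.unique ((hFs z).mul_left _)]
    simp
  have := H (C * B) (fun k => hermiteCoeff ψ (Function.update α j k)) F hFs
    (fun z => (hFn z).trans_eq (by rw [hB]; ring))
    (fun z => by
      rw [hFG]
      refine (hGn _).trans_eq ?_
      rw [hB]
      simp only [Complex.mul_im, Complex.mul_re, Complex.I_re, Complex.I_im]
      ring_nf) (α j)
  simp only [Function.update_eq_self] at this
  refine this.trans_eq ?_
  ring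

theorem theorem4p7 (n : ℕ) (hn : 1 ≤ n) (t : ℝ) (ht : 0 < t) :
    ∃ K : ℝ, ∀ (C : ℝ) (ψ : Lp ℂ 2 (volume : Measure (EuclideanSpace ℝ (Fin n)))),
      (∀ᵐ x, ‖ψ x‖ ≤ C * Real.exp (-(Real.tanh (2 * t) / 2) * ‖x‖ ^ 2)) →
      (∀ᵐ ξ, ‖unitaryFourier ψ ξ‖ ≤ C * Real.exp (-(Real.tanh (2 * t) / 2) * ‖ξ‖ ^ 2)) →
      ∀ α : Fin n → ℕ,
        ‖hermiteCoeff ψ α‖ ≤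
          K * C * (∏ j, (2 * (α j : ℝ) + 1) ^ (-(1 / (4 * (n : ℝ))))) *
            Real.exp (-((2 * ((∑ j, α j : ℕ) : ℝ) + n) * t / (2 * n))) := by
  obtain ⟨K, hK, H⟩ := exists_norm_hermiteCoeff_le n ht
  refine ⟨K, fun C ψ h1 h2 α => ?_⟩
  have hC : 0 ≤ C := by
    obtain ⟨x, hx⟩ := h1.exists
    exact nonneg_of_mul_nonneg_left ((norm_nonneg _).trans hx) (Real.exp_pos _)
  have hn0 : (0 : ℝ) < n := by exact_mod_cast hn
  have hj := H C ψ hC h1 h2 α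
  -- Writing `x` as a product of `n` copies of its `n`-th root lets copy `j` be estimated by the
  -- bound in index `j`.
  have hroot : ∀ {x : ℝ}, 0 ≤ x → x = ∏ _j : Fin n, x ^ (1 / (n : ℝ)) := by
    intro x hx
    rw [Finset.prod_const, Finset.card_univ, Fintype.card_fin, ← Real.rpow_natCast,
      ← Real.rpow_mul hx, one_div_mul_cancel hn0.ne', Real.rpow_one]
  have hKC : 0 ≤ K * C := mul_nonneg hK hC
  calc ‖hermiteCoeff ψ α‖ = ∏ _j : Fin n, ‖hermiteCoeff ψ α‖ ^ (1 / (n : ℝ)) :=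
        hroot (norm_nonneg _)
    _ ≤ ∏ j, (K * C * (2 * (α j : ℝ) + 1) ^ (-(1 / 4) : ℝ) *
          Real.exp (-((2 * (α j : ℝ) + 1) * t / 2))) ^ (1 / (n : ℝ)) := by
        gcongr with j
        exact hj j
    _ = ∏ j, ((K * C) ^ (1 / (n : ℝ)) * (2 * (α j : ℝ) + 1) ^ (-(1 / (4 * (n : ℝ)))) *
          Real.exp (-((2 * (α j : ℝ) + 1) * t / 2) * (1 / n))) := by
        refine Finset.prod_congr rfl fun j _ => ?_
        rw [Real.mul_rpow (by positivity) (by positivity), Real.mul_rpow hKC (by positivity),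
          ← Real.rpow_mul (by positivity), ← Real.exp_mul]
        congr 3
        field_simp
    _ = _ := by
        rw [Finset.prod_mul_distrib, Finset.prod_mul_distrib, ← hroot hKC, ← Real.exp_sum,
          ← Finset.sum_mul, Finset.sum_neg_distrib, ← Finset.sum_div, ← Finset.sum_mul,
          Finset.sum_add_distrib, ← Finset.mul_sum]
        congr 2
        simp
        field_simp
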